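/- \textbf{Theorem.} Let $n\ge 0$, let $\pi'\in S_n$ be a permutation whose diagram is a (possibly empty) partition with north-west most box $(1,1)$, and let $\pi=1\pi'\in S_{n+1}$, i.e. $\pi(1)=1$ and $\pi(i+1)=\pi'(i)+1$. Then the map $M$ is a bijection from the set of reduced pipe dreams of $\pi$ onto the set of noncrossing alternating spanning trees of the directed transitive closure of $T(\pi)$. The notions are as follows; a box $(r,c)$ lies in row $r$ (from the top) and column $c$ (from the left). \emph{Diagram.} $D(\sigma)=\{(\sigma_j,i): i<j,\ \sigma_i>\sigma_j\}$. \emph{Reduced pipe dreams.} A reduced pipe dream of $\sigma\in S_N$ is a tiling of the $N\times N$ matrix by crosses (joining left to right and bottom to top) and elbows (joining left to top and bottom to right) such that every tile $(r,c)$ with $r+c>N$ is an elbow, the strand starting on the left of row $\sigma_j$ comes out on the top of column $j$ for every $j$, and no two strands cross twice. \emph{The region $R(\pi)$.} Let $B$ be the set of boxes obtained by aligning $D(\pi)$ to the left (the crosses of the bottom reduced pipe dream) and $U$ the set obtained by aligning $D(\pi)$ up. Then $R(\pi)=\{(1,1)\}\cup B\cup U$. Its south-east boundary, from the south-west corner to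 the north-east corner, consists of one east step $E_c$ below each column $c$ and one north step $N_r$ on the right of each row $r$. \emph{Labels.} Let $A$ be the set of all north steps, the first step $E_1$, and all those steps $E_c$ that bound $B$ and whose directly preceding step is not a north step that bounds $B$. Number the steps in $A$ by $1,\dots,m$ along the boundary; an east step not in $A$ gets the number of the north step directly preceding it. Each box $(r,c)\in R(\pi)$ is assigned the edge $(i,j)$, where $i$ is the label of $E_c$ and $j$ the label of $N_r$. \emph{The tree $T(\pi)$.} Put a dot in each box of $R(\pi)\setminus B$ and drop the dots south, i.e. if column $c$ contains $d$ dots, move them to the $d$ lowest boxes of column $c$ of $R(\pi)$. $T(\pi)$ is the graph on the vertex set $\{1,\dots,m\}$ whose edges are those assigned to the boxes that then contain a dot. \emph{Trees.} The directed transitive closure of a graph $G$ on $\{1,\dots,m\}$ has the edges $(i,j)$, $i<j$, for which $G$ contains a path from $i$ to $j$ with increasing vertices. A spanning tree of it is alternating if it has no edges $(i,j),(j,k)$ with $i<j<k$, and noncrossing if it has no edges $(i,k),(j,l)$ with $i<j<k<l$. \emph{The map $M$.} $M$ sends a reduced pipe dream $P$ of $\pi$ to the graph on $\{1,\dots,m\}$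 whose edges are the edges assigned to the boxes of $R(\pi)$ that are elbows of $P$, together with the edge $(1,m)$. -/

import Mathlib

/-! Matrix coordinates are used throughout: a box is a pair `(r, c)` of positive integers, `r` being
its row (counted from the top) and `c` its column (counted from the left). A permutation of
`{1, …, n}` is an `Equiv.Perm (Fin n)`; the element `i : Fin n` stands for `i + 1`. -/

namespace PipeDreams

/-- The permutation `1π'` of `{1, …, n + 1}`: it fixes `1` and acts on `{2, …, n + 1}` as `π'`. -/
def onePlus {n : ℕ} (σ : Equiv.Perm (Fin n)) : Equiv.Perm (Fin (n + 1)) :=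
  Equiv.Perm.decomposeFin.symm (0, σ)

theorem onePlus_zero {n : ℕ} (σ : Equiv.Perm (Fin n)) : onePlus σ 0 = 0 := by
  simp [onePlus]

theorem onePlus_succ {n : ℕ} (σ : Equiv.Perm (Fin n)) (i : Fin n) :
    onePlus σ i.succ = (σ i).succ := by
  simp [onePlus]

/-- The Rothe diagram `{(π_j, i) : i < j, π_i > π_j}`. -/
def rotheDiagram {n : ℕ} (π : Equiv.Perm (Fin n)) : Finset (ℕ × ℕ) :=
  ((Finset.univ : Finset (Fin n × Fin n)).filter (fun p => p.1 < p.2 ∧ π p.2 < π p.1)).image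
    (fun p => ((π p.2 : ℕ) + 1, (p.1 : ℕ) + 1))

/-- A set of boxes is the diagram of a (possibly empty) partition whose north-west most box
is `(1, 1)`. -/
def IsPartition (S : Finset (ℕ × ℕ)) : Prop :=
  ∀ r c, (r, c) ∈ S → ∀ r' c', 1 ≤ r' → r' ≤ r → 1 ≤ c' → c' ≤ c → (r', c') ∈ S

/-- The number of boxes of `S` in row `r`. -/
def rowLength (S : Finset (ℕ × ℕ)) (r : ℕ) : ℕ := (S.filter (fun b => b.1 = r)).card

/-- The number of boxes of `S` in column `c`. -/
def colLength (S : Finset (ℕ × ℕ)) (c : ℕ) : ℕ := (S.filter (fun b => b.2 = c)).card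

/-! ### Reduced pipe dreams

A tiling of the `n × n` matrix by crosses and elbows is encoded by the set `C` of its crosses. -/

/-- The side through which a strand enters a box. -/
inductive Side
  | left
  | bottom

/-- `Enters C k s r c`: the strand that starts on the left of row `k` enters the box `(r, c)`
through its side `s`. A cross joins left to right and bottom to top, an elbow joins left to top and
bottom to right. `Enters C k .bottom 0 c` means that the strand leaves the matrix through the top of
column `c`. -/
inductive Enters (C : Finset (ℕ × ℕ)) (k : ℕ) : Side → ℕ → ℕ → Prop
  | start : Enters C k .left k 1
  | left_cross (r c : ℕ) : Enters C k .left (r + 1) c → (r + 1, c) ∈ C →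
      Enters C k .left (r + 1) (c + 1)
  | left_elbow (r c : ℕ) : Enters C k .left (r + 1) c → (r + 1, c) ∉ C →
      Enters C k .bottom r c
  | bottom_cross (r c : ℕ) : Enters C k .bottom (r + 1) c → (r + 1, c) ∈ C →
      Enters C k .bottom r c
  | bottom_elbow (r c : ℕ) : Enters C k .bottom (r + 1) c → (r + 1, c) ∉ C →
      Enters C k .left (r + 1) (c + 1)

/-- The strand `k` passes through the box `b`. -/
def Passes (C : Finset (ℕ × ℕ)) (k : ℕ) (b : ℕ × ℕ) : Prop :=
  ∃ s, Enters C k s b.1 b.2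

/-- `C` is the set of crosses of a reduced pipe dream for `π ∈ S_n`. -/
structure IsReducedPipeDream {n : ℕ} (π : Equiv.Perm (Fin n)) (C : Finset (ℕ × ℕ)) : Prop where
  /-- The crosses are boxes of the matrix, and none lies in the weak south-east triangle. -/
  northWest : ∀ r c, (r, c) ∈ C → 1 ≤ r ∧ 1 ≤ c ∧ r + c ≤ n
  /-- The strands come out on the top and read `π`. -/
  reads : ∀ j : Fin n, Enters C ((π j : ℕ) + 1) .bottom 0 ((j : ℕ) + 1)
  /-- No two strands cross twice. -/
  reduced : ∀ i k, 1 ≤ i → i < k → k ≤ n → ∀ b ∈ C, ∀ b' ∈ C,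
    Passes C i b → Passes C k b → Passes C i b' → Passes C k b' → b = b'

/-- The set of reduced pipe dreams of `π`. -/
def reducedPipeDreams {n : ℕ} (π : Equiv.Perm (Fin n)) : Set (Finset (ℕ × ℕ)) :=
  {C | IsReducedPipeDream π C}

/-! ### The core region and the tree `T(π)` -/

/-- The crosses of the bottom reduced pipe dream: the diagram of `π` aligned to the left. -/
def bottomDream {n : ℕ} (π : Equiv.Perm (Fin n)) : Finset (ℕ × ℕ) :=
  (Finset.Icc 1 n ×ˢ Finset.Icc 1 n).filter (fun b => b.2 ≤ rowLength (rotheDiagram π) b.1)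

/-- The crosses of the top reduced pipe dream: the diagram of `π` aligned up. -/
def topDream {n : ℕ} (π : Equiv.Perm (Fin n)) : Finset (ℕ × ℕ) :=
  (Finset.Icc 1 n ×ˢ Finset.Icc 1 n).filter (fun b => b.1 ≤ colLength (rotheDiagram π) b.2)

/-- The core region `cr(π)`: the superimposition of the bottom and the top reduced pipe dreams. -/
def coreRegion {n : ℕ} (π : Equiv.Perm (Fin n)) : Finset (ℕ × ℕ) :=
  bottomDream π ∪ topDream π

/-- The region `R(π)`. -/
def region {n : ℕ} (π : Equiv.Perm (Fin n)) : Finset (ℕ × ℕ) :=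
  insert (1, 1) (coreRegion π)

/-- The rows of `R(π)`. Each of them ends, on its right, in one `N` step of the south-east
boundary of `R(π)`. -/
def rows {n : ℕ} (π : Equiv.Perm (Fin n)) : Finset ℕ := (region π).image Prod.fst

/-- The columns of `R(π)`. Each of them ends, below, in one `E` step of the south-east
boundary of `R(π)`. -/
def cols {n : ℕ} (π : Equiv.Perm (Fin n)) : Finset ℕ := (region π).image Prod.snd

/-- The `E` step below column `c` belongs to the set `A` of numbered steps: it is the first step of
the boundary, or it bounds the bottom reduced pipe dream while the step directly preceding it is not
an `N` step that bounds the bottom reduced pipe dream. The `E` step lies below the box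
`(colLength (region π) c, c)`; if the preceding step is an `N` step, this one is on the right of the
box `(colLength (region π) c + 1, c - 1)`, and otherwise the latter box is not in `R(π)`. -/
def EInA {n : ℕ} (π : Equiv.Perm (Fin n)) (c : ℕ) : Prop :=
  c = 1 ∨ ((colLength (region π) c, c) ∈ bottomDream π ∧
    (colLength (region π) c + 1, c - 1) ∉ bottomDream π)

instance {n : ℕ} (π : Equiv.Perm (Fin n)) : DecidablePred (EInA π) :=
  fun _ => inferInstanceAs (Decidable (_ ∨ (_ ∧ _)))

/-- The label of the `E` step below column `c`: the number of steps in `A` (all `N` steps are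
in `A`) up to and including this step, when the boundary is traversed from south-west to north-east.
(The `N` step of row `r` comes before the `E` step of column `c` iff `(r, c) ∉ R(π)`.) If
the `E` step is not in `A`, this is the number of the `N` step directly preceding it. -/
def eLabel {n : ℕ} (π : Equiv.Perm (Fin n)) (c : ℕ) : ℕ :=
  ((cols π).filter (fun c' => c' ≤ c ∧ EInA π c')).card +
    ((rows π).filter (fun r => (r, c) ∉ region π)).card

/-- The label of the `N` step on the right of row `r`: the number of steps in `A` up to and
including this step. -/
def nLabel {n : ℕ} (π : Equiv.Perm (Fin n)) (r : ℕ) : ℕ :=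
  ((cols π).filter (fun c => (r, c) ∈ region π ∧ EInA π c)).card +
    ((rows π).filter (fun r' => r ≤ r')).card

/-- The number `m` of vertices of `T(π)`: the number of steps in `A`. -/
def numVertices {n : ℕ} (π : Equiv.Perm (Fin n)) : ℕ :=
  ((cols π).filter (fun c => EInA π c)).card + (rows π).card

/-- The dots that encode `T(π)`: the elbows of the bottom reduced pipe dream in `R(π)`, dropped
south within their columns of `R(π)`. The box `(r, c)` of `R(π)` has a dot iff fewer boxes of its
column are below it than there are elbows in this column. -/
def droppedDots {n : ℕ} (π : Equiv.Perm (Fin n)) : Finset (ℕ × ℕ) :=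
  (region π).filter (fun b =>
    ((region π).filter (fun b' => b'.2 = b.2 ∧ b.1 < b'.1)).card <
      colLength (region π \ bottomDream π) b.2)

/-- The graph on `{1, …, m}` with the edges `(i, j)` coming from the boxes in `S`: `i` is the label
of the `E` step below the box and `j` the label of the `N` step on the right of the box.
The vertex `v : Fin m` stands for `v + 1`. -/
def boxGraph {n : ℕ} (π : Equiv.Perm (Fin n)) (S : Finset (ℕ × ℕ)) :
    SimpleGraph (Fin (numVertices π)) :=
  SimpleGraph.fromRel (fun u v =>
    ∃ b ∈ S, eLabel π b.2 = (u : ℕ) + 1 ∧ nLabel π b.1 = (v : ℕ) + 1)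

/-- The tree `T(π)`. -/
def tree {n : ℕ} (π : Equiv.Perm (Fin n)) : SimpleGraph (Fin (numVertices π)) :=
  boxGraph π (droppedDots π)

/-! ### The map `M` and the noncrossing alternating spanning trees -/

/-- The map `M`: a pipe dream is sent to the graph with the edges of its elbows in `R(π)`, together
with the edge `(1, m)`. -/
def mapM {n : ℕ} (π : Equiv.Perm (Fin n)) (C : Finset (ℕ × ℕ)) :
    SimpleGraph (Fin (numVertices π)) :=
  boxGraph π (region π \ C) ⊔
    SimpleGraph.fromRel (fun u v => (u : ℕ) + 1 = 1 ∧ (v : ℕ) + 1 = numVertices π)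

/-- The directed transitive closure of a graph on `{1, …, m}` whose edges are directed from the
smaller to the larger vertex. -/
def dirTransClosure {m : ℕ} (G : SimpleGraph (Fin m)) : SimpleGraph (Fin m) :=
  SimpleGraph.fromRel (Relation.TransGen (fun u v => u < v ∧ G.Adj u v))

/-- No vertex has both a smaller and a larger neighbour. -/
def IsAlternating {m : ℕ} (F : SimpleGraph (Fin m)) : Prop :=
  ∀ i j k, i < j → j < k → ¬ (F.Adj i j ∧ F.Adj j k)

/-- No two edges cross when the vertices are put on a line and the edges are drawn as arcs
above it. -/
def IsNoncrossing {m : ℕ} (F : SimpleGraph (Fin m)) : Prop :=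
  ∀ i j k l, i < j → j < k → k < l → ¬ (F.Adj i k ∧ F.Adj j l)

/-- The noncrossing alternating spanning trees of a graph `G`. -/
def ncAltSpanningTrees {m : ℕ} (G : SimpleGraph (Fin m)) : Set (SimpleGraph (Fin m)) :=
  {F | F ≤ G ∧ F.IsTree ∧ IsNoncrossing F ∧ IsAlternating F}

end PipeDreams

namespace PipeDreams

/-! ### Strands, column by column -/

/-! Let `g c` be the length of column `c` of the diagram of `π'`, with `g 0 = g 1`, and consider the
shape with column heights `height g c = g (c - 1) + 1`. On the columns of R(π) it is R(π) together
with an extra box at the foot of each column with `g c < g (c - 1)`, an outer corner. There the east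
step is not in A and shares the label of the preceding north step, so the corner stands for a loop
(`nLabel_eq_eLabel_iff`). Both sides of the bijection are encoded by the same sets of elbows,
described column by column in `IsMaximalFilling`.

Trees: the closure of T(π) has one edge for every box of R(π) (`dirTransClosure_tree`). Two boxes in
north-east to south-west position give edges (i,k), (j,l) with i < j and k < l. They cross if the
box at their south-east lies in R(π), and violate alternation (j = k) if it is an outer corner.
Hence noncrossing and alternating together mean `IsFilling`. Such graphs are acyclic
(`IsNoncrossing.isAcyclic`), so a tree contains every box compatible with it, which forces the
column description. Conversely, in a maximal filling every column shares a row with an earlier one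
and every row is met, so the graph is connected.

Pipe dreams: reducedness says that the smaller strand goes horizontally through every cross
(`isReducedPipeDream_iff`). In a maximal filling, rows without elbows so far hold their own strands,
and a covered row holds the strand of the next covered row of the shape (`StrandInvariant`). The
last covered row `t` of column `c + 1` then holds the smallest remaining strand exceeding the height
of that column. As `π'` is dominant, this strand is `π (c + 1)`, so the column reads correctly
exactly when its first elbow is in row `t`. Conversely, a strand below a larger one leaves later, so
it is bounded by a later column height; this excludes crosses below the shape and rows still
uncovered when they end. -/

theorem exists_elbow_gt (C : Finset (ℕ × ℕ)) (c r : ℕ) : ∃ s, r < s ∧ (s, c) ∉ C := by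
  by_contra! H
  refine Set.infinite_of_injective_forall_mem (s := (C : Set (ℕ × ℕ)))
    (f := fun k : ℕ => (r + 1 + k, c)) ?_ ?_ C.finite_toSet
  · intro a b hab
    simpa using hab
  · intro k
    exact H _ (by omega)

/-- The row of the first elbow of column `c` strictly below row `r`. -/
def nextElbow (C : Finset (ℕ × ℕ)) (c r : ℕ) : ℕ := Nat.find (exists_elbow_gt C c r)

theorem lt_nextElbow (C : Finset (ℕ × ℕ)) (c r : ℕ) : r < nextElbow C c r :=
  (Nat.find_spec (exists_elbow_gt C c r)).1

theorem nextElbow_notMem (C : Finset (ℕ × ℕ)) (c r : ℕ) : (nextElbow C c r, c) ∉ C :=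
  (Nat.find_spec (exists_elbow_gt C c r)).2

theorem mem_of_lt_nextElbow {C : Finset (ℕ × ℕ)} {c r s : ℕ} (h : r < s)
    (h' : s < nextElbow C c r) : (s, c) ∈ C := by
  by_contra hs
  exact Nat.find_min (exists_elbow_gt C c r) h' ⟨h, hs⟩

theorem nextElbow_le {C : Finset (ℕ × ℕ)} {c r s : ℕ} (h : r < s) (h' : (s, c) ∉ C) :
    nextElbow C c r ≤ s := by
  by_contra! H
  exact h' (mem_of_lt_nextElbow h H)

theorem nextElbow_eq {C : Finset (ℕ × ℕ)} {c r s : ℕ} (h : r < s) (h' : (s, c) ∉ C)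
    (H : ∀ q, r < q → q < s → (q, c) ∈ C) : nextElbow C c r = s := by
  refine le_antisymm (nextElbow_le h h') ?_
  by_contra! hs
  exact nextElbow_notMem C c r (H _ (lt_nextElbow C c r) hs)

theorem nextElbow_eq_of_mem {C : Finset (ℕ × ℕ)} {c q r : ℕ} (h : q < r)
    (hr : r < nextElbow C c q) : nextElbow C c r = nextElbow C c q :=
  nextElbow_eq hr (nextElbow_notMem C c q) fun _ h1 h2 => mem_of_lt_nextElbow (h.trans h1) h2

/-- The row in which the strand that leaves column `c` on the right of row `r` enters column `c`,
the rows of vertically entering strands being those of the elbows where they turned. -/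
def source (C : Finset (ℕ × ℕ)) (c r : ℕ) : ℕ := if (r, c) ∈ C then r else nextElbow C c r

theorem source_of_mem {C : Finset (ℕ × ℕ)} {c r : ℕ} (h : (r, c) ∈ C) : source C c r = r :=
  if_pos h

theorem source_of_notMem {C : Finset (ℕ × ℕ)} {c r : ℕ} (h : (r, c) ∉ C) :
    source C c r = nextElbow C c r := if_neg h

theorem le_source (C : Finset (ℕ × ℕ)) (c r : ℕ) : r ≤ source C c r := by
  unfold source
  split_ifs
  · exact le_rfl
  · exact (lt_nextElbow C c r).le

/-- Two strands change their vertical order within a column only at a cross, where the lower one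
goes straight and the other passes it vertically. -/
theorem source_lt_or {C : Finset (ℕ × ℕ)} {c q r : ℕ} (h : q < r) :
    source C c q < source C c r ∨
      ((r, c) ∈ C ∧ source C c q = nextElbow C c r ∧ source C c r = r) := by
  by_cases hq : (q, c) ∈ C
  · left
    rw [source_of_mem hq]
    exact h.trans_le (le_source C c r)
  · rw [source_of_notMem hq]
    by_cases hr : r < nextElbow C c q
    · have hrC := mem_of_lt_nextElbow h hr
      exact Or.inr ⟨hrC, (nextElbow_eq_of_mem h hr).symm, source_of_mem hrC⟩
    · left
      push Not at hr
      refine lt_of_le_of_ne (hr.trans (le_source C c r)) ?_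
      intro he
      have h1 : (r, c) ∉ C := by
        have : nextElbow C c q = r := le_antisymm hr (he ▸ le_source C c r)
        exact this ▸ nextElbow_notMem C c q
      have := lt_nextElbow C c r
      rw [source_of_notMem h1] at he
      omega

theorem source_injective (C : Finset (ℕ × ℕ)) (c : ℕ) : Function.Injective (source C c) := by
  have key : ∀ q r, q < r → source C c q ≠ source C c r := by
    intro q r h
    rcases source_lt_or (C := C) (c := c) h with h1 | ⟨-, h1, h2⟩
    · exact h1.ne
    · rw [h1, h2]
      exact (lt_nextElbow C c r).ne'
  intro q r h
  rcases lt_trichotomy q r with h' | h' | h'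
  · exact absurd h (key _ _ h')
  · exact h'
  · exact absurd h.symm (key _ _ h')

/-- Above any row there is an elbow (possibly in row `0`) sending its vertical strand there. -/
theorem exists_elbow_lt {C : Finset (ℕ × ℕ)} (hC : ∀ r c, (r, c) ∈ C → 1 ≤ r) (c : ℕ) {r : ℕ}
    (hr : 1 ≤ r) : ∃ q, q < r ∧ (q, c) ∉ C ∧ ∀ s, q < s → s < r → (s, c) ∈ C := by
  induction r, hr using Nat.le_induction with
  | base => exact ⟨0, by omega, fun h => absurd (hC _ _ h) (by omega), by omega⟩
  | succ r hr ih =>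
    by_cases h : (r, c) ∈ C
    · obtain ⟨q, h1, h2, h3⟩ := ih
      refine ⟨q, by omega, h2, fun s hs hs' => ?_⟩
      rcases (Nat.lt_succ_iff_lt_or_eq.1 hs') with h4 | rfl
      · exact h3 s hs h4
      · exact h
    · exact ⟨r, by omega, h, fun s hs hs' => by omega⟩

theorem exists_source_eq {C : Finset (ℕ × ℕ)} (hC : ∀ r c, (r, c) ∈ C → 1 ≤ r) (c : ℕ) {r : ℕ}
    (hr : 1 ≤ r) : ∃ q, source C c q = r := by
  by_cases h : (r, c) ∈ C
  · exact ⟨r, source_of_mem h⟩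
  · obtain ⟨q, h1, h2, h3⟩ := exists_elbow_lt hC c hr
    exact ⟨q, (source_of_notMem h2).trans (nextElbow_eq h1 h h3)⟩

/-- The strand that enters the box `(r, c + 1)` from the left. For `r = 0 < c` this is the strand
that leaves through the top of column `c`. -/
def strandAt (C : Finset (ℕ × ℕ)) : ℕ → ℕ → ℕ
  | 0, r => r
  | c + 1, r => strandAt C c (source C (c + 1) r)

theorem strandAt_zero (C : Finset (ℕ × ℕ)) (r : ℕ) : strandAt C 0 r = r := rfl

theorem strandAt_succ (C : Finset (ℕ × ℕ)) (c r : ℕ) :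
    strandAt C (c + 1) r = strandAt C c (source C (c + 1) r) := rfl

theorem strandAt_succ_of_mem {C : Finset (ℕ × ℕ)} {c r : ℕ} (h : (r, c + 1) ∈ C) :
    strandAt C (c + 1) r = strandAt C c r := by
  rw [strandAt_succ, source_of_mem h]

theorem strandAt_succ_of_notMem {C : Finset (ℕ × ℕ)} {c r : ℕ} (h : (r, c + 1) ∉ C) :
    strandAt C (c + 1) r = strandAt C c (nextElbow C (c + 1) r) := by
  rw [strandAt_succ, source_of_notMem h]

theorem strandAt_injective (C : Finset (ℕ × ℕ)) (c : ℕ) :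
    Function.Injective (strandAt C c) := by
  induction c with
  | zero => exact fun _ _ h => h
  | succ c ih => exact ih.comp (source_injective C (c + 1))

/-- Strands only move up on their way to the right, so tracing one back leads weakly down. -/
theorem exists_strandAt_of_le (C : Finset (ℕ × ℕ)) {d c : ℕ} (h : d ≤ c) (r : ℕ) :
    ∃ q, r ≤ q ∧ strandAt C d q = strandAt C c r := by
  induction c, h using Nat.le_induction generalizing r with
  | base => exact ⟨r, le_rfl, rfl⟩
  | succ c h ih =>
    obtain ⟨q, h1, h2⟩ := ih (source C (c + 1) r)
    exact ⟨q, (le_source C (c + 1) r).trans h1, h2⟩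

theorem strandAt_pos (C : Finset (ℕ × ℕ)) (c : ℕ) {r : ℕ} (hr : 1 ≤ r) : 1 ≤ strandAt C c r := by
  obtain ⟨q, h1, h2⟩ := exists_strandAt_of_le C (Nat.zero_le c) r
  rw [← h2, strandAt_zero]
  omega

theorem strandAt_ne_exit (C : Finset (ℕ × ℕ)) {d c r : ℕ} (h : d ≤ c) (hr : 1 ≤ r) :
    strandAt C c r ≠ strandAt C d 0 := by
  obtain ⟨q, h1, h2⟩ := exists_strandAt_of_le C h r
  rw [← h2]
  intro h3
  have := strandAt_injective C d h3
  omega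

theorem exists_row_or_exit {C : Finset (ℕ × ℕ)} (hC : ∀ r c, (r, c) ∈ C → 1 ≤ r) (c : ℕ) {v : ℕ}
    (hv : 1 ≤ v) :
    (∃ r, 1 ≤ r ∧ strandAt C c r = v) ∨ ∃ d, 1 ≤ d ∧ d ≤ c ∧ strandAt C d 0 = v := by
  induction c with
  | zero => exact Or.inl ⟨v, hv, rfl⟩
  | succ c ih =>
    rcases ih with ⟨r, hr, h⟩ | ⟨d, h1, h2, h3⟩
    · obtain ⟨q, hq⟩ := exists_source_eq hC (c + 1) hr
      rcases Nat.eq_zero_or_pos q with rfl | hq0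
      · exact Or.inr ⟨c + 1, by omega, le_rfl, by rw [strandAt_succ, hq, h]⟩
      · exact Or.inl ⟨q, hq0, by rw [strandAt_succ, hq, h]⟩
    · exact Or.inr ⟨d, h1, by omega, h3⟩

/-- Outside the staircase all tiles are elbows, so going back one column lowers a strand at most to
the next antidiagonal. -/
theorem strandAt_le {C : Finset (ℕ × ℕ)} {N : ℕ} (hN : ∀ r c, (r, c) ∈ C → r + c ≤ N)
    (c : ℕ) {r : ℕ} (h : r + c ≤ N) : strandAt C c r ≤ N := by
  induction c generalizing r with
  | zero => rw [strandAt_zero]; omega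
  | succ c ih =>
    rw [strandAt_succ]
    apply ih
    unfold source
    split_ifs with h1
    · omega
    · have : nextElbow C (c + 1) r ≤ N - c :=
        nextElbow_le (by omega) fun hm => by have := hN _ _ hm; omega
      omega

/-- Every cross is traversed by the smaller strand from left to right. -/
def CrossesOrdered (C : Finset (ℕ × ℕ)) : Prop :=
  ∀ r c, (r, c + 1) ∈ C → strandAt C c r < strandAt C c (nextElbow C (c + 1) r)

/-- A swap in an ordered dream always brings the larger strand on top. A smaller strand above a
larger one has therefore been above it in all earlier columns. -/
theorem CrossesOrdered.above_of_le {C : Finset (ℕ × ℕ)} (h : CrossesOrdered C) {d c q r : ℕ}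
    (hd : d ≤ c) (hqr : q < r) (hs : strandAt C c q < strandAt C c r) :
    ∃ q' r', q' < r' ∧ strandAt C d q' = strandAt C c q ∧ strandAt C d r' = strandAt C c r := by
  induction c, hd using Nat.le_induction generalizing q r with
  | base => exact ⟨q, r, hqr, rfl, rfl⟩
  | succ c hd ih =>
    rcases source_lt_or (C := C) (c := c + 1) hqr with h1 | ⟨h1, h2, h3⟩
    · exact ih h1 hs
    · have := h r c h1
      rw [strandAt_succ, strandAt_succ, h2, h3] at hs
      omega

/-- If a larger strand is above a smaller one then it exits first. -/
theorem CrossesOrdered.exit_lt {C : Finset (ℕ × ℕ)} (hC : ∀ r c, (r, c) ∈ C → 1 ≤ r)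
    (h : CrossesOrdered C) {c d q r : ℕ} (hq : 1 ≤ q) (hqr : q < r)
    (hs : strandAt C c r < strandAt C c q) (hcd : c < d) (hd : strandAt C d 0 = strandAt C c r) :
    ∃ d', c < d' ∧ d' < d ∧ strandAt C d' 0 = strandAt C c q := by
  rcases exists_row_or_exit hC d (strandAt_pos C c hq) with ⟨s, hs1, hs2⟩ | ⟨d', h1, h2, h3⟩
  -- If the larger strand were still inside when the smaller one is in row `0`, the order could be
  -- traced back to column `c`, where it is the opposite.
  · obtain ⟨q', r', h1, h2, h3⟩ := h.above_of_le hcd.le (q := 0) (r := s) (by omega)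
      (by rw [hd, hs2]; exact hs)
    rw [hd] at h2
    rw [hs2] at h3
    have e1 := strandAt_injective C c h2
    have e2 := strandAt_injective C c h3
    omega
  · refine ⟨d', ?_, ?_, h3⟩
    · by_contra! h4
      exact strandAt_ne_exit C h4 hq h3.symm
    · refine lt_of_le_of_ne h2 ?_
      rintro rfl
      omega

/-! ### Agreement with the tile-by-tile strands, and reducedness -/

theorem Enters.strandAt_eq {C : Finset (ℕ × ℕ)} {k : ℕ} {s : Side} {r c : ℕ}
    (h : Enters C k s r c) : ∃ c', c = c' + 1 ∧
      match s with
      | .left => strandAt C c' r = k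
      | .bottom => strandAt C c' (nextElbow C c r) = k := by
  induction h with
  | start => exact ⟨0, rfl, rfl⟩
  | left_cross r c _ hm ih =>
    obtain ⟨c', rfl, h⟩ := ih
    exact ⟨c' + 1, rfl, (strandAt_succ_of_mem hm).trans h⟩
  | left_elbow r c _ hm ih =>
    obtain ⟨c', rfl, h⟩ := ih
    refine ⟨c', rfl, ?_⟩
    have : nextElbow C (c' + 1) r = r + 1 := nextElbow_eq (by omega) hm (by omega)
    simpa only [this] using h
  | bottom_cross r c _ hm ih =>
    obtain ⟨c', rfl, h⟩ := ih
    refine ⟨c', rfl, ?_⟩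
    have : nextElbow C (c' + 1) r = nextElbow C (c' + 1) (r + 1) := by
      refine nextElbow_eq ?_ (nextElbow_notMem _ _ _) fun q h1 h2 => ?_
      · have := lt_nextElbow C (c' + 1) (r + 1)
        omega
      · rcases Nat.eq_or_lt_of_le (Nat.succ_le_of_lt h1) with h3 | h3
        · exact h3 ▸ hm
        · exact mem_of_lt_nextElbow h3 h2
    simpa only [this] using h
  | bottom_elbow r c _ hm ih =>
    obtain ⟨c', rfl, h⟩ := ih
    exact ⟨c' + 1, rfl, (strandAt_succ_of_notMem hm).trans h⟩

theorem enters_bottom_of_left {C : Finset (ℕ × ℕ)} {k r c s : ℕ} (hrs : r < s) (hs : (s, c) ∉ C)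
    (h : ∀ q, r < q → q < s → (q, c) ∈ C) (he : Enters C k .left s c) :
    Enters C k .bottom r c := by
  obtain ⟨d, rfl⟩ : ∃ d, s = r + 1 + d := ⟨s - (r + 1), by omega⟩
  induction d generalizing r with
  | zero => exact .left_elbow r c he hs
  | succ d ih =>
    refine .bottom_cross r c ?_ (h _ (by omega) (by omega))
    have e : r + 1 + (d + 1) = (r + 1) + 1 + d := by omega
    rw [e] at he hs h
    exact ih (by omega) hs (fun q h1 h2 => h q (by omega) h2) he

theorem enters_left_strandAt (C : Finset (ℕ × ℕ)) (c : ℕ) {r : ℕ} (hr : 1 ≤ r) :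
    Enters C (strandAt C c r) .left r (c + 1) := by
  induction c generalizing r with
  | zero => exact .start
  | succ c ih =>
    obtain ⟨r, rfl⟩ : ∃ r', r = r' + 1 := ⟨r - 1, by omega⟩
    by_cases h : (r + 1, c + 1) ∈ C
    · rw [strandAt_succ_of_mem h]
      exact .left_cross r (c + 1) (ih hr) h
    · rw [strandAt_succ_of_notMem h]
      refine .bottom_elbow r (c + 1) ?_ h
      have h1 := lt_nextElbow C (c + 1) (r + 1)
      exact enters_bottom_of_left h1 (nextElbow_notMem _ _ _)
        (fun q => mem_of_lt_nextElbow) (ih (by omega))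

theorem enters_bottom_strandAt (C : Finset (ℕ × ℕ)) (c r : ℕ) :
    Enters C (strandAt C c (nextElbow C (c + 1) r)) .bottom r (c + 1) := by
  have h1 := lt_nextElbow C (c + 1) r
  exact enters_bottom_of_left h1 (nextElbow_notMem _ _ _)
    (fun q => mem_of_lt_nextElbow) (enters_left_strandAt C c (by omega))

theorem enters_bottom_zero_iff {C : Finset (ℕ × ℕ)} (hC : ∀ r c, (r, c) ∈ C → 1 ≤ r) {k c : ℕ} :
    Enters C k .bottom 0 (c + 1) ↔ strandAt C (c + 1) 0 = k := by
  -- Row `0` has no crosses, so it acts as a row of elbows and receives the strand leaving at the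
  -- top.
  have h0 : (0, c + 1) ∉ C := fun h => absurd (hC _ _ h) (by omega)
  rw [strandAt_succ_of_notMem h0]
  constructor
  · intro h
    obtain ⟨c', h1, h2⟩ := h.strandAt_eq
    obtain rfl : c = c' := by omega
    exact h2
  · rintro rfl
    exact enters_bottom_strandAt C c 0

theorem passes_iff {C : Finset (ℕ × ℕ)} {k r c : ℕ} (hr : 1 ≤ r) :
    Passes C k (r, c + 1) ↔
      strandAt C c r = k ∨ strandAt C c (nextElbow C (c + 1) r) = k := by
  constructor
  · rintro ⟨s, h⟩
    obtain ⟨c', h1, h2⟩ := h.strandAt_eq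
    obtain rfl : c = c' := by simpa using h1
    cases s
    · exact Or.inl h2
    · exact Or.inr h2
  · rintro (rfl | rfl)
    · exact ⟨.left, enters_left_strandAt C c hr⟩
    · exact ⟨.bottom, enters_bottom_strandAt C c r⟩

/-- Two strands that have been swapped have met at a cross. -/
theorem exists_cross_of_swapped {C : Finset (ℕ × ℕ)} (hC : ∀ r c, (r, c) ∈ C → 1 ≤ r)
    {c q r : ℕ} (hqr : q < r) (hs : strandAt C c r < strandAt C c q) :
    ∃ r' c', c' < c ∧ (r', c' + 1) ∈ C ∧ Passes C (strandAt C c r) (r', c' + 1) ∧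
      Passes C (strandAt C c q) (r', c' + 1) := by
  induction c generalizing q r with
  | zero => simp only [strandAt_zero] at hs; omega
  | succ c ih =>
    rcases source_lt_or (C := C) (c := c + 1) hqr with h1 | ⟨h1, h2, h3⟩
    · obtain ⟨r', c', h4, h5⟩ := ih h1 hs
      exact ⟨r', c', by omega, h5⟩
    · refine ⟨r, c, by omega, h1, ?_, ?_⟩
      · rw [passes_iff (hC _ _ h1), strandAt_succ, h3]
        exact Or.inl rfl
      · rw [passes_iff (hC _ _ h1), strandAt_succ, h2]
        exact Or.inr rfl

theorem CrossesOrdered.cross_unique {C : Finset (ℕ × ℕ)} (hC : ∀ r c, (r, c) ∈ C → 1 ≤ r)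
    (h : CrossesOrdered C) {i k r c r' c' : ℕ} (hik : i < k) (hb : (r, c + 1) ∈ C)
    (hb' : (r', c' + 1) ∈ C) (h1 : Passes C i (r, c + 1)) (h2 : Passes C k (r, c + 1))
    (h3 : Passes C i (r', c' + 1)) (h4 : Passes C k (r', c' + 1)) : r = r' ∧ c = c' := by
  have key : ∀ r c, (r, c + 1) ∈ C → Passes C i (r, c + 1) → Passes C k (r, c + 1) →
      strandAt C c r = i ∧ strandAt C c (nextElbow C (c + 1) r) = k := by
    intro r c hb h1 h2
    rw [passes_iff (hC _ _ hb)] at h1 h2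
    have := h r c hb
    omega
  have main : ∀ r c r' c', (r, c + 1) ∈ C → (r', c' + 1) ∈ C → strandAt C c r = i →
      strandAt C c (nextElbow C (c + 1) r) = k → strandAt C c' r' = i →
      strandAt C c' (nextElbow C (c' + 1) r') = k → ¬ c < c' := by
    intro r c r' c' hb hb' e1 e2 e3 e4 hcc
    obtain ⟨q, p, hqp, e5, e6⟩ := h.above_of_le (d := c + 1) (c := c') (by omega)
      (lt_nextElbow C (c' + 1) r') (by rw [e3, e4]; exact hik)
    -- Right of column `c + 1` strand `i` is in row `r` and strand `k` in the higher row `s` where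
    -- it has turned, contrary to `q < p`.
    obtain ⟨s, hs1, hs2, hs3⟩ := exists_elbow_lt hC (c + 1) (hC _ _ hb)
    have e7 : strandAt C (c + 1) r = i := (strandAt_succ_of_mem hb).trans e1
    have e8 : strandAt C (c + 1) s = k := by
      rw [strandAt_succ_of_notMem hs2, ← e2]
      congr 1
      refine nextElbow_eq (hs1.trans (lt_nextElbow _ _ _)) (nextElbow_notMem _ _ _) ?_
      intro q h1 h2
      rcases lt_trichotomy q r with h3 | rfl | h3
      · exact hs3 q h1 h3
      · exact hb
      · exact mem_of_lt_nextElbow h3 h2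
    have e9 := strandAt_injective C (c + 1) (e5.trans (e3.trans e7.symm))
    have e10 := strandAt_injective C (c + 1) (e6.trans (e4.trans e8.symm))
    omega
  obtain ⟨e1, e2⟩ := key r c hb h1 h2
  obtain ⟨e3, e4⟩ := key r' c' hb' h3 h4
  have m1 := main r c r' c' hb hb' e1 e2 e3 e4
  have m2 := main r' c' r c hb' hb e3 e4 e1 e2
  obtain rfl : c = c' := by omega
  exact ⟨strandAt_injective C c (e1.trans e3.symm), rfl⟩

/-- Strands start sorted, so their first meeting sends the smaller one straight. A cross in the
wrong order needs an earlier meeting; if all crosses are ordered, a second meeting is impossible. -/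
theorem isReducedPipeDream_iff {N : ℕ} (π : Equiv.Perm (Fin N)) (C : Finset (ℕ × ℕ)) :
    IsReducedPipeDream π C ↔ (∀ r c, (r, c) ∈ C → 1 ≤ r ∧ 1 ≤ c ∧ r + c ≤ N) ∧
      (∀ j : Fin N, strandAt C ((j : ℕ) + 1) 0 = (π j : ℕ) + 1) ∧ CrossesOrdered C := by
  constructor
  · intro h
    have hC : ∀ r c, (r, c) ∈ C → 1 ≤ r := fun r c hm => (h.northWest r c hm).1
    have hN : ∀ r c, (r, c) ∈ C → r + c ≤ N := fun r c hm => (h.northWest r c hm).2.2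
    refine ⟨h.northWest, fun j => (enters_bottom_zero_iff hC).1 (h.reads j), ?_⟩
    intro r c hm
    have hr := h.northWest r _ hm
    have hlt := lt_nextElbow C (c + 1) r
    by_contra! hle
    have hlt' : strandAt C c (nextElbow C (c + 1) r) < strandAt C c r :=
      lt_of_le_of_ne hle fun he => by have := strandAt_injective C c he; omega
    obtain ⟨r', c', h1, h2, h3, h4⟩ := exists_cross_of_swapped hC hlt hlt'
    have := h.reduced _ _ (strandAt_pos C c (by omega)) hlt'
      (strandAt_le hN c (by omega)) _ h2 _ hm h3 h4 ((passes_iff hr.1).2 (Or.inr rfl))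
      ((passes_iff hr.1).2 (Or.inl rfl))
    simp only [Prod.mk.injEq] at this
    omega
  · rintro ⟨h1, h2, h3⟩
    have hC : ∀ r c, (r, c) ∈ C → 1 ≤ r := fun r c hm => (h1 r c hm).1
    refine ⟨h1, fun j => (enters_bottom_zero_iff hC).2 (h2 j), ?_⟩
    rintro i k - hik - ⟨r, c⟩ hb ⟨r', c'⟩ hb' p1 p2 p3 p4
    obtain ⟨c, rfl⟩ : ∃ d, c = d + 1 := ⟨c - 1, by have := h1 _ _ hb; omega⟩
    obtain ⟨c', rfl⟩ : ∃ d, c' = d + 1 := ⟨c' - 1, by have := h1 _ _ hb'; omega⟩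
    obtain ⟨rfl, rfl⟩ := h3.cross_unique hC hik hb hb' p1 p2 p3 p4
    rfl

/-! ### Pipe dreams whose elbows form a maximal filling -/

/-- Row `r` contains an elbow in one of the first `c` columns. -/
def Covered (C : Finset (ℕ × ℕ)) (c r : ℕ) : Prop := ∃ c', 1 ≤ c' ∧ c' ≤ c ∧ (r, c') ∉ C

theorem Covered.mono {C : Finset (ℕ × ℕ)} {c d r : ℕ} (h : Covered C c r) (hcd : c ≤ d) :
    Covered C d r := by
  obtain ⟨c', h1, h2, h3⟩ := h
  exact ⟨c', h1, h2.trans hcd, h3⟩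

theorem covered_of_notMem {C : Finset (ℕ × ℕ)} {c r : ℕ} (hc : 1 ≤ c) (h : (r, c) ∉ C) :
    Covered C c r := ⟨c, hc, le_rfl, h⟩

theorem covered_succ {C : Finset (ℕ × ℕ)} {c r : ℕ} (h : Covered C (c + 1) r) :
    Covered C c r ∨ (r, c + 1) ∉ C := by
  obtain ⟨c', h1, h2, h3⟩ := h
  rcases Nat.lt_or_ge c c' with h4 | h4
  · obtain rfl : c' = c + 1 := by omega
    exact Or.inr h3
  · exact Or.inl ⟨c', h1, h4, h3⟩

theorem covered_one {C : Finset (ℕ × ℕ)} {r : ℕ} : Covered C 1 r ↔ (r, 1) ∉ C := by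
  constructor
  · rintro ⟨c', h1, h2, h3⟩
    obtain rfl : c' = 1 := by omega
    exact h3
  · exact covered_of_notMem le_rfl

/-- `t` is the last row of column `c + 1` of the shape with column heights `h` that has an elbow in
an earlier column. -/
structure IsTop (h : ℕ → ℕ) (C : Finset (ℕ × ℕ)) (c t : ℕ) : Prop where
  pos : 1 ≤ t
  le : t ≤ h (c + 1)
  covered : Covered C c t
  max : ∀ r, t < r → r ≤ h (c + 1) → ¬ Covered C c r

theorem exists_isTop {h : ℕ → ℕ} (h1 : ∀ c, 1 ≤ h c) {C : Finset (ℕ × ℕ)} (hC : (1, 1) ∉ C)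
    {c : ℕ} (hc : 1 ≤ c) : ∃ t, IsTop h C c t := by
  classical
  have hcov : Covered C c 1 := (covered_one.2 hC).mono hc
  have hP := Nat.findGreatest_spec (P := fun r => Covered C c r) (h1 (c + 1)) hcov
  refine ⟨Nat.findGreatest (fun r => Covered C c r) (h (c + 1)), ?_, Nat.findGreatest_le _, hP, ?_⟩
  · exact Nat.le_findGreatest (h1 (c + 1)) hcov
  · intro r hr hr' hcr
    exact (Nat.le_findGreatest hr' hcr).not_gt hr

/-- In column `c + 1` the elbows of the shape start in row `t`, and all boxes below the shape are
elbows. -/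
structure IsNextColumn (h : ℕ → ℕ) (C : Finset (ℕ × ℕ)) (c t : ℕ) : Prop where
  elbow : (t, c + 1) ∉ C
  above : ∀ r, 1 ≤ r → r < t → (r, c + 1) ∈ C
  below : ∀ r, h (c + 1) < r → (r, c + 1) ∉ C

/-- The elbows of `C` form a maximal filling of the shape with column heights `h`: every column
starts in the last row that is already covered, and every row is covered when it ends. -/
structure IsMaximalFilling (h : ℕ → ℕ) (C : Finset (ℕ × ℕ)) : Prop where
  pos : ∀ r c, (r, c) ∈ C → 1 ≤ r ∧ 1 ≤ c
  corner : (1, 1) ∉ C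
  column : ∀ c, 1 ≤ c → ∃ t, IsTop h C c t ∧ IsNextColumn h C c t
  covered : ∀ c, 1 ≤ c → ∀ r, h (c + 1) < r → Covered C c r

/-- The strands after column `c`, expressed through the covered rows. -/
structure StrandInvariant (h : ℕ → ℕ) (C : Finset (ℕ × ℕ)) (c : ℕ) : Prop where
  uncovered : ∀ r, 1 ≤ r → ¬ Covered C c r → strandAt C c r = r
  next : ∀ r r', 1 ≤ r → r < r' → r' ≤ h (c + 1) → Covered C c r → Covered C c r' →
    (∀ q, r < q → q < r' → ¬ Covered C c q) → strandAt C c r = r'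
  last : ∀ r, 1 ≤ r → Covered C c r → (∀ r', r < r' → r' ≤ h (c + 1) → ¬ Covered C c r') →
    h (c + 1) < strandAt C c r
  strictMono : ∀ r r', 1 ≤ r → r < r' → Covered C c r → Covered C c r' →
    strandAt C c r < strandAt C c r'

theorem StrandInvariant.one (h : ℕ → ℕ) (C : Finset (ℕ × ℕ)) : StrandInvariant h C 1 := by
  have hcross : ∀ r, ¬ Covered C 1 r → (r, 1) ∈ C := fun r hr => by
    by_contra hn
    exact hr (covered_one.2 hn)
  have helb : ∀ r, Covered C 1 r → strandAt C 1 r = nextElbow C 1 r := fun r hr =>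
    strandAt_succ_of_notMem (covered_one.1 hr)
  refine ⟨fun r _ hr => strandAt_succ_of_mem (hcross r hr), ?_, ?_, ?_⟩
  · intro r r' _ hrr _ hc hc' hq
    rw [helb r hc]
    exact nextElbow_eq hrr (covered_one.1 hc') fun q h1 h2 => hcross q (hq q h1 h2)
  · intro r _ hc hq
    rw [helb r hc]
    by_contra! hle
    exact hq _ (lt_nextElbow C 1 r) hle (covered_one.2 (nextElbow_notMem C 1 r))
  · intro r r' _ hrr hc hc'
    rw [helb r hc, helb r' hc']
    exact (nextElbow_le hrr (covered_one.1 hc')).trans_lt (lt_nextElbow C 1 r')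

/-- A covered row before the top row holds the strand of the next covered row. -/
theorem StrandInvariant.exists_next {h : ℕ → ℕ} {C : Finset (ℕ × ℕ)} {c t r : ℕ}
    (J : StrandInvariant h C c) (ht : IsTop h C c t) (hr : 1 ≤ r) (hrt : r < t)
    (hc : Covered C c r) :
    ∃ a, r < a ∧ a ≤ t ∧ Covered C c a ∧ (∀ q, r < q → q < a → ¬ Covered C c q) ∧
      strandAt C c r = a := by
  classical
  have hex : ∃ a, r < a ∧ Covered C c a := ⟨t, hrt, ht.covered⟩
  have hle : Nat.find hex ≤ t := Nat.find_min' hex ⟨hrt, ht.covered⟩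
  have hmin : ∀ q, r < q → q < Nat.find hex → ¬ Covered C c q :=
    fun q h1 h2 h3 => Nat.find_min hex h2 ⟨h1, h3⟩
  obtain ⟨h1, h2⟩ := Nat.find_spec hex
  exact ⟨Nat.find hex, h1, hle, h2, hmin,
    J.next r _ hr h1 (hle.trans ht.le) hc h2 hmin⟩

theorem StrandInvariant.lt_of_lt {h : ℕ → ℕ} {C : Finset (ℕ × ℕ)} {c r : ℕ}
    (J : StrandInvariant h C c) (hcov : ∀ r, h (c + 1) < r → Covered C c r)
    (hr : h (c + 1) < r) : h (c + 1) < strandAt C c r :=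
  J.last r (by omega) (hcov r hr) fun r' h1 h2 => by omega

/-- Rows above `t` are crosses and keep their strands. From `t` on the covered rows are elbows, and
each takes the strand of the next elbow; within the shape that row was uncovered and still held its
own number. -/
theorem StrandInvariant.succ {h : ℕ → ℕ} (hanti : Antitone h) {C : Finset (ℕ × ℕ)} {c t : ℕ}
    (J : StrandInvariant h C c) (hcov : ∀ r, h (c + 1) < r → Covered C c r)
    (ht : IsTop h C c t) (hcol : IsNextColumn h C c t) : StrandInvariant h C (c + 1) := by
  have hh : h (c + 1 + 1) ≤ h (c + 1) := hanti (Nat.le_succ _)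
  have htpos := ht.pos
  have htle := ht.le
  have hcross : ∀ r, ¬ Covered C (c + 1) r → (r, c + 1) ∈ C := fun r hr => by
    by_contra hn
    exact hr (covered_of_notMem (by omega) hn)
  have hlow : ∀ r, 1 ≤ r → r < t → Covered C (c + 1) r →
      Covered C c r ∧ strandAt C (c + 1) r = strandAt C c r := fun r hr hrt hc =>
    ⟨(covered_succ hc).resolve_right fun hn => hn (hcol.above r hr hrt),
      strandAt_succ_of_mem (hcol.above r hr hrt)⟩
  have helb : ∀ r, t ≤ r → Covered C (c + 1) r → (r, c + 1) ∉ C := by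
    intro r htr hc
    rcases Nat.eq_or_lt_of_le htr with rfl | htr
    · exact hcol.elbow
    · by_cases hr : r ≤ h (c + 1)
      · exact (covered_succ hc).resolve_left (ht.max r htr hr)
      · exact hcol.below r (by omega)
  have hnext : ∀ r, t ≤ r → Covered C (c + 1) r →
      strandAt C (c + 1) r = strandAt C c (nextElbow C (c + 1) r) := fun r htr hc =>
    strandAt_succ_of_notMem (helb r htr hc)
  have hid : ∀ s, t < s → s ≤ h (c + 1) → strandAt C c s = s := fun s hs hs' =>
    J.uncovered s (by omega) (ht.max s hs hs')
  refine ⟨?_, ?_, ?_, ?_⟩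
  · intro r hr hc
    rw [strandAt_succ_of_mem (hcross r hc)]
    exact J.uncovered r hr fun hc' => hc (hc'.mono (by omega))
  · intro r r' hr hrr hr' hc hc' hq
    have hq' : ∀ q, r < q → q < r' → ¬ Covered C c q :=
      fun q h1 h2 h3 => hq q h1 h2 (h3.mono (by omega))
    rcases Nat.lt_or_ge r t with hrt | hrt
    · obtain ⟨h1, h2⟩ := hlow r hr hrt hc
      have hr't : r' ≤ t := by
        by_contra! h3
        exact hq' t hrt h3 ht.covered
      have h3 : Covered C c r' := by
        rcases Nat.eq_or_lt_of_le hr't with rfl | h4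
        · exact ht.covered
        · exact (hlow r' (by omega) h4 hc').1
      rw [h2]
      exact J.next r r' hr hrr (by omega) h1 h3 hq'
    · rw [hnext r hrt hc, nextElbow_eq hrr (helb r' (by omega) hc')
        fun q h1 h2 => hcross q (hq q h1 h2)]
      exact hid r' (by omega) (by omega)
  · intro r hr hc hq
    rcases Nat.lt_or_ge r t with hrt | hrt
    · obtain ⟨h1, h2⟩ := hlow r hr hrt hc
      obtain ⟨a, h3, -, h4, -, h5⟩ := J.exists_next ht hr hrt h1
      rw [h2, h5]
      -- The next column may end above row `t`; then the strand `a` already exceeds its height.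
      by_contra! h6
      exact hq a h3 h6 (h4.mono (by omega))
    · rw [hnext r hrt hc]
      have hs := lt_nextElbow C (c + 1) r
      have hs2 : h (c + 1 + 1) < nextElbow C (c + 1) r := by
        by_contra! h6
        exact hq _ hs h6 (covered_of_notMem (by omega) (nextElbow_notMem _ _ _))
      rcases Nat.lt_or_ge (h (c + 1)) (nextElbow C (c + 1) r) with h6 | h6
      · exact hh.trans_lt (J.lt_of_lt hcov h6)
      · rw [hid _ (by omega) h6]
        exact hs2
  · intro r r' hr hrr hc hc'
    rcases Nat.lt_or_ge r' t with hrt' | hrt'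
    · obtain ⟨h1, h2⟩ := hlow r hr (by omega) hc
      obtain ⟨h3, h4⟩ := hlow r' (by omega) hrt' hc'
      rw [h2, h4]
      exact J.strictMono r r' hr hrr h1 h3
    · rw [hnext r' hrt' hc']
      have hs' := lt_nextElbow C (c + 1) r'
      rcases Nat.lt_or_ge r t with hrt | hrt
      · obtain ⟨h1, h2⟩ := hlow r hr hrt hc
        rw [h2]
        rcases Nat.lt_or_ge (h (c + 1)) (nextElbow C (c + 1) r') with h6 | h6
        · exact J.strictMono _ _ hr (by omega) h1 (hcov _ h6)
        · obtain ⟨a, -, h3, -, -, h5⟩ := J.exists_next ht hr hrt h1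
          rw [h5, hid _ (by omega) h6]
          omega
      · rw [hnext r hrt hc]
        have hs := lt_nextElbow C (c + 1) r
        have hss : nextElbow C (c + 1) r ≤ r' := nextElbow_le hrr (helb r' hrt' hc')
        rcases Nat.lt_or_ge (h (c + 1)) (nextElbow C (c + 1) r') with h6 | h6
        · rcases Nat.lt_or_ge (h (c + 1)) (nextElbow C (c + 1) r) with h7 | h7
          · exact J.strictMono _ _ (by omega) (by omega) (hcov _ h7) (hcov _ h6)
          · rw [hid _ (by omega) h7]
            exact h7.trans_lt (J.lt_of_lt hcov h6)
        · rw [hid _ (by omega) h6, hid _ (by omega) (by omega)]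
          omega

/-- The one-line notation `p` of a permutation `1π'` of `{1, …, N}`, with `π'` dominant: column
`d ≥ 2` of its diagram consists of the rows `2, …, h d`. -/
structure IsReading (N : ℕ) (h p : ℕ → ℕ) : Prop where
  one_le : 1 ≤ N
  one : p 1 = 1
  pos : ∀ d, 1 ≤ d → d ≤ N → 1 ≤ p d
  le : ∀ d, 1 ≤ d → d ≤ N → p d ≤ N
  inj : ∀ d e, 1 ≤ d → d ≤ N → 1 ≤ e → e ≤ N → p d = p e → d = e
  surj : ∀ v, 1 ≤ v → v ≤ N → ∃ d, 1 ≤ d ∧ d ≤ N ∧ p d = v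
  lt : ∀ d, 2 ≤ d → d ≤ N → h d < p d
  le_height : ∀ d e, 1 ≤ d → d < e → e ≤ N → p e < p d → p e ≤ h d
  large : ∀ d, N < d → h d = 1
  height_pos : ∀ d, 1 ≤ h d
  antitone : Antitone h

/-- The top row holds the strand that has to leave next. -/
theorem StrandInvariant.strandAt_top {N : ℕ} {h p : ℕ → ℕ} (hp : IsReading N h p)
    {C : Finset (ℕ × ℕ)} (hC : ∀ r c, (r, c) ∈ C → 1 ≤ r) {c t : ℕ}
    (J : StrandInvariant h C c) (hcov : ∀ r, h (c + 1) < r → Covered C c r)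
    (ht : IsTop h C c t) (hc : 1 ≤ c) (hcN : c + 1 ≤ N)
    (hread : ∀ d, 1 ≤ d → d ≤ c → strandAt C d 0 = p d) : strandAt C c t = p (c + 1) := by
  have htpos := ht.pos
  have htle := ht.le
  have hlt := hp.lt (c + 1) (by omega) hcN
  have hw := J.last t ht.pos ht.covered ht.max
  rcases exists_row_or_exit hC c (hp.pos (c + 1) (by omega) hcN) with
    ⟨r, hr, hr'⟩ | ⟨d, h1, h2, h3⟩
  · have hrc : Covered C c r := by
      by_contra hn
      rw [J.uncovered r hr hn] at hr'
      exact hn (hcov r (by omega))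
    have htr : t ≤ r := by
      by_contra! hrt
      obtain ⟨a, -, h3, -, -, h5⟩ := J.exists_next ht hr hrt hrc
      omega
    rcases Nat.eq_or_lt_of_le htr with rfl | htr
    · exact hr'
    -- Row `t` would hold a strand strictly between `h (c + 1)` and `p (c + 1)`. It has not been
    -- read yet because it is still inside, and `le_height` forbids reading it later.
    · exfalso
      have hlt' := J.strictMono t r htpos htr ht.covered hrc
      rw [hr'] at hlt'
      have := hp.le (c + 1) (by omega) hcN
      obtain ⟨e, he1, he2, he3⟩ := hp.surj _ (strandAt_pos C c htpos) (by omega)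
      rcases lt_trichotomy e (c + 1) with h6 | rfl | h6
      · refine strandAt_ne_exit C (Nat.le_of_lt_succ h6) htpos ?_
        rw [hread e he1 (by omega), he3]
      · omega
      · have := hp.le_height (c + 1) e (by omega) h6 he2 (by omega)
        omega
  · rw [hread d h1 h2] at h3
    have := hp.inj d (c + 1) h1 (by omega) (by omega) hcN h3
    omega

theorem nextElbow_zero_eq {h : ℕ → ℕ} {C : Finset (ℕ × ℕ)} {c t : ℕ} (ht : 1 ≤ t)
    (hcol : IsNextColumn h C c t) : nextElbow C (c + 1) 0 = t :=
  nextElbow_eq (by omega) hcol.elbow fun q h1 h2 => hcol.above q h1 h2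

theorem IsMaximalFilling.strandInvariant {h : ℕ → ℕ} (hanti : Antitone h) {C : Finset (ℕ × ℕ)}
    (hC : IsMaximalFilling h C) {c : ℕ} (hc : 1 ≤ c) : StrandInvariant h C c := by
  induction c, hc using Nat.le_induction with
  | base => exact .one h C
  | succ c hc ih =>
    obtain ⟨t, ht, hcol⟩ := hC.column c hc
    exact ih.succ hanti (hC.covered c hc) ht hcol

theorem IsMaximalFilling.strandAt_exit {N : ℕ} {h p : ℕ → ℕ} (hp : IsReading N h p)
    {C : Finset (ℕ × ℕ)} (hC : IsMaximalFilling h C) (c : ℕ) (hc : 1 ≤ c) (hcN : c ≤ N) :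
    strandAt C c 0 = p c := by
  induction c using Nat.strong_induction_on with
  | _ c ih =>
    have h0 : (0, c) ∉ C := fun hm => absurd (hC.pos _ _ hm).1 (by omega)
    obtain ⟨c, rfl⟩ : ∃ d, c = d + 1 := ⟨c - 1, by omega⟩
    rw [strandAt_succ_of_notMem h0]
    rcases Nat.eq_zero_or_pos c with rfl | hc'
    · rw [strandAt_zero, hp.one]
      exact nextElbow_eq one_pos hC.corner (by omega)
    · obtain ⟨t, ht, hcol⟩ := hC.column c hc'
      rw [nextElbow_zero_eq ht.pos hcol]
      exact (hC.strandInvariant hp.antitone hc').strandAt_top hp (fun r c hm => (hC.pos r c hm).1)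
        (hC.covered c hc') ht hc' hcN fun d h1 h2 => ih d (by omega) h1 (by omega)

/-- Above `t` the vertical strand at a cross comes from row `t`. Below `t` a cross lies in an
uncovered row, which holds its own number, and the strand coming from below is larger. -/
theorem IsMaximalFilling.crossesOrdered {h : ℕ → ℕ} (hanti : Antitone h) {C : Finset (ℕ × ℕ)}
    (hC : IsMaximalFilling h C) : CrossesOrdered C := by
  intro r c hm
  have hr := (hC.pos r _ hm).1
  have hs := lt_nextElbow C (c + 1) r
  rcases Nat.eq_zero_or_pos c with rfl | hc
  · exact hs
  · have J := hC.strandInvariant hanti hc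
    obtain ⟨t, ht, hcol⟩ := hC.column c hc
    have htle := ht.le
    rcases Nat.lt_trichotomy r t with hrt | rfl | hrt
    · have : nextElbow C (c + 1) r = t :=
        nextElbow_eq hrt hcol.elbow fun q h1 h2 => hcol.above q (by omega) h2
      rw [this]
      by_cases hcr : Covered C c r
      · exact J.strictMono r t hr hrt hcr ht.covered
      · rw [J.uncovered r hr hcr]
        have := J.last t ht.pos ht.covered ht.max
        omega
    · exact absurd hm hcol.elbow
    · have hrh : r ≤ h (c + 1) := by
        by_contra! hn
        exact hcol.below r hn hm
      rw [J.uncovered r hr (ht.max r hrt hrh)]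
      rcases Nat.lt_or_ge (h (c + 1)) (nextElbow C (c + 1) r) with h6 | h6
      · exact hrh.trans_lt (J.lt_of_lt (hC.covered c hc) h6)
      · rw [J.uncovered _ (by omega) (ht.max _ (by omega) h6)]
        exact hs

/-! ### Reduced pipe dreams give maximal fillings -/

/-- The properties of the crosses of a reduced pipe dream for `p`. -/
structure IsReadingDream (N : ℕ) (p : ℕ → ℕ) (C : Finset (ℕ × ℕ)) : Prop where
  northWest : ∀ r c, (r, c) ∈ C → 1 ≤ r ∧ 1 ≤ c ∧ r + c ≤ N
  reads : ∀ d, 1 ≤ d → d ≤ N → strandAt C d 0 = p d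
  ordered : CrossesOrdered C

/-- The larger strand above leaves first, in a column after `c + 1`. The two strands thus form an
inversion of `p`, and the smaller value is bounded by the height of that column. -/
theorem IsReadingDream.le_height_of_inverted {N : ℕ} {h p : ℕ → ℕ} (hp : IsReading N h p)
    {C : Finset (ℕ × ℕ)} (hC : IsReadingDream N p C) {c q r : ℕ} (hm : (r, c + 1) ∈ C)
    (hq : 1 ≤ q) (hqr : q < r) (hlt : strandAt C (c + 1) r < strandAt C (c + 1) q) :
    strandAt C (c + 1) r ≤ h (c + 1 + 1) := by
  have hpos : ∀ r c, (r, c) ∈ C → 1 ≤ r := fun r c hm => (hC.northWest r c hm).1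
  have hnw := hC.northWest _ _ hm
  have hN : strandAt C (c + 1) r ≤ N := by
    rw [strandAt_succ_of_mem hm]
    exact strandAt_le (fun r c hm => (hC.northWest r c hm).2.2) c (by omega)
  obtain ⟨e, he1, he2, he3⟩ := hp.surj _ (strandAt_pos C (c + 1) hnw.1) hN
  have hce : c + 1 < e := by
    by_contra! hec
    refine strandAt_ne_exit C hec hnw.1 ?_
    rw [hC.reads e he1 he2, he3]
  obtain ⟨d, h1, h2, h3⟩ := hC.ordered.exit_lt hpos hq hqr hlt hce
    (by rw [hC.reads e he1 he2, he3])
  rw [hC.reads d (by omega) (by omega)] at h3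
  rw [← he3, ← h3] at hlt
  rw [← he3]
  exact (hp.le_height d e (by omega) h2 he2 hlt).trans (hp.antitone (by omega))

/-- The vertical strand of the cross turns right at the first elbow above it, which puts a larger
strand above row `r` right of this column. -/
theorem IsReadingDream.le_height_of_elbow_above {N : ℕ} {h p : ℕ → ℕ} (hp : IsReading N h p)
    {C : Finset (ℕ × ℕ)} (hC : IsReadingDream N p C) {c t r : ℕ} (hm : (r, c + 1) ∈ C)
    (ht : 1 ≤ t) (htr : t < r) (htC : (t, c + 1) ∉ C) :
    strandAt C c r ≤ h (c + 1 + 1) := by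
  have hpos : ∀ r c, (r, c) ∈ C → 1 ≤ r := fun r c hm => (hC.northWest r c hm).1
  obtain ⟨q, h1, h2, h3⟩ := exists_elbow_lt hpos (c + 1) (hpos _ _ hm)
  have hqt : t ≤ q := by
    by_contra! hlt
    exact htC (h3 t hlt htr)
  have he : nextElbow C (c + 1) r = nextElbow C (c + 1) q := by
    refine nextElbow_eq_of_mem h1 ?_
    by_contra! hle
    rcases Nat.eq_or_lt_of_le hle with h4 | h4
    · exact nextElbow_notMem C (c + 1) q (h4 ▸ hm)
    · exact nextElbow_notMem C (c + 1) q (h3 _ (lt_nextElbow _ _ _) h4)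
  have hlt := hC.ordered r c hm
  rw [← strandAt_succ_of_mem hm]
  refine hC.le_height_of_inverted hp hm (by omega) h1 ?_
  rw [strandAt_succ_of_mem hm, strandAt_succ_of_notMem h2, ← he]
  exact hlt

theorem exists_covered_lt {C : Finset (ℕ × ℕ)} {c r : ℕ} (h1 : Covered C c 1) (hr : 1 < r) :
    ∃ a, 1 ≤ a ∧ a < r ∧ Covered C c a ∧ ∀ q, a < q → q < r → ¬ Covered C c q := by
  induction r, hr using Nat.le_induction with
  | base => exact ⟨1, le_rfl, by omega, h1, by omega⟩
  | succ r hr ih =>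
    by_cases hc : Covered C c r
    · exact ⟨r, by omega, by omega, hc, by omega⟩
    · obtain ⟨a, h2, h3, h4, h5⟩ := ih
      refine ⟨a, h2, by omega, h4, fun q h6 h7 => ?_⟩
      rcases Nat.lt_succ_iff_lt_or_eq.1 h7 with h8 | rfl
      · exact h5 q h6 h8
      · exact hc

theorem IsReadingDream.corner {N : ℕ} {h p : ℕ → ℕ} (hp : IsReading N h p)
    {C : Finset (ℕ × ℕ)} (hC : IsReadingDream N p C) : (1, 1) ∉ C := by
  have h0 : (0, 0 + 1) ∉ C := fun hm => absurd (hC.northWest _ _ hm).1 (by omega)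
  have h1 := hC.reads 1 le_rfl hp.one_le
  rw [strandAt_succ_of_notMem h0, strandAt_zero, hp.one] at h1
  have h2 := nextElbow_notMem C 1 0
  rwa [h1] at h2

theorem IsReadingDream.isNextColumn {N : ℕ} {h p : ℕ → ℕ} (hp : IsReading N h p)
    {C : Finset (ℕ × ℕ)} (hC : IsReadingDream N p C) {c t : ℕ} (hc : 1 ≤ c)
    (J : StrandInvariant h C c) (hcov : ∀ r, h (c + 1) < r → Covered C c r)
    (ht : IsTop h C c t) : IsNextColumn h C c t := by
  have hpos : ∀ r c, (r, c) ∈ C → 1 ≤ r := fun r c hm => (hC.northWest r c hm).1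
  have htpos := ht.pos
  have htle := ht.le
  have h1 : (t, c + 1) ∉ C ∧ ∀ r, 1 ≤ r → r < t → (r, c + 1) ∈ C := by
    by_cases hcN : c + 1 ≤ N
    · have h2 := hC.reads (c + 1) (by omega) hcN
      have h0 : (0, c + 1) ∉ C := fun hm => absurd (hpos _ _ hm) (by omega)
      rw [strandAt_succ_of_notMem h0, ← J.strandAt_top hp hpos hcov ht hc hcN
        fun d h1 h2 => hC.reads d h1 (by omega)] at h2
      have h3 := strandAt_injective C c h2
      rw [← h3]
      exact ⟨nextElbow_notMem _ _ _, fun r h4 h5 => mem_of_lt_nextElbow h4 h5⟩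
    -- Right of column `N` the shape has height `1`, so `t = 1`, and there are no crosses.
    · have := hp.large (c + 1) (by omega)
      exact ⟨fun hm => by have := hC.northWest _ _ hm; omega, fun r _ _ => by omega⟩
  refine ⟨h1.1, h1.2, fun r hr hm => ?_⟩
  have h2 := hC.le_height_of_elbow_above hp hm htpos (by omega) h1.1
  have h3 := J.lt_of_lt hcov hr
  have : h (c + 1 + 1) ≤ h (c + 1) := hp.antitone (by omega)
  omega

theorem IsReadingDream.covered_succ {N : ℕ} {h p : ℕ → ℕ} (hp : IsReading N h p)
    {C : Finset (ℕ × ℕ)} (hC : IsReadingDream N p C) {c t : ℕ} (hc : 1 ≤ c)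
    (J : StrandInvariant h C c) (hcov : ∀ r, h (c + 1) < r → Covered C c r)
    (ht : IsTop h C c t) {r : ℕ} (hr : h (c + 1 + 1) < r) : Covered C (c + 1) r := by
  have hcol := hC.isNextColumn hp hc J hcov ht
  have hrpos : 1 ≤ r := by omega
  by_contra hn
  have hn' : ¬ Covered C c r := fun h' => hn (h'.mono (by omega))
  have hm : (r, c + 1) ∈ C := by
    by_contra h'
    exact hn (covered_of_notMem (by omega) h')
  have hrr := J.uncovered r hrpos hn'
  rcases Nat.lt_trichotomy r t with hrt | rfl | hrt
  · have hcov1 : Covered C c 1 := (covered_one.2 (hC.corner hp)).mono hc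
    have hr1 : 1 < r := lt_of_le_of_ne hrpos fun h' => hn' (h' ▸ hcov1)
    -- The nearest covered row above `r` holds the strand of the next covered row `b`, which is
    -- below `r`. So strand `r` runs under a larger one.
    obtain ⟨a, h1, h2, h3, h4⟩ := exists_covered_lt hcov1 hr1
    obtain ⟨b, h5, h6, h7, h8, h9⟩ := J.exists_next ht h1 (by omega) h3
    have hrb : r < b := by
      by_contra! hbr
      rcases Nat.eq_or_lt_of_le hbr with rfl | hbr
      · exact hn' h7
      · exact h4 b h5 hbr h7
    have h10 := hC.le_height_of_inverted hp hm h1 h2 (by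
      rw [strandAt_succ_of_mem hm, strandAt_succ_of_mem (hcol.above a h1 (by omega)), hrr, h9]
      exact hrb)
    rw [strandAt_succ_of_mem hm, hrr] at h10
    omega
  · exact hcol.elbow hm
  · have h10 := hC.le_height_of_elbow_above hp hm ht.pos hrt hcol.elbow
    omega

/-- The two parts are proved together: the strands after a column determine the shape of the next
one, and coverage is needed to propagate them. -/
theorem IsReadingDream.invariant {N : ℕ} {h p : ℕ → ℕ} (hp : IsReading N h p)
    {C : Finset (ℕ × ℕ)} (hC : IsReadingDream N p C) {c : ℕ} (hc : 1 ≤ c) :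
    StrandInvariant h C c ∧ ∀ r, h (c + 1) < r → Covered C c r := by
  induction c, hc using Nat.le_induction with
  | base =>
    refine ⟨.one h C, fun r hr => covered_one.2 fun hm => ?_⟩
    have h1 := hp.height_pos (1 + 1)
    have h2 : r ≤ h (1 + 1) :=
      hC.le_height_of_elbow_above (c := 0) hp hm le_rfl (by omega) (hC.corner hp)
    omega
  | succ c hc ih =>
    obtain ⟨t, ht⟩ := exists_isTop hp.height_pos (hC.corner hp) hc
    exact ⟨ih.1.succ hp.antitone ih.2 ht (hC.isNextColumn hp hc ih.1 ih.2 ht),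
      fun r hr => hC.covered_succ hp hc ih.1 ih.2 ht hr⟩

theorem IsReadingDream.isMaximalFilling {N : ℕ} {h p : ℕ → ℕ} (hp : IsReading N h p)
    {C : Finset (ℕ × ℕ)} (hC : IsReadingDream N p C) : IsMaximalFilling h C where
  pos r c hm := ⟨(hC.northWest r c hm).1, (hC.northWest r c hm).2.1⟩
  corner := hC.corner hp
  column c hc := by
    obtain ⟨t, ht⟩ := exists_isTop hp.height_pos (hC.corner hp) hc
    have := hC.invariant hp hc
    exact ⟨t, ht, hC.isNextColumn hp hc this.1 this.2 ht⟩
  covered c hc := (hC.invariant hp hc).2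

/-! ### The labels of the boundary steps -/

/-- The region `R(π)` and the bottom reduced pipe dream are given by the partition with column
lengths `g 1, g 2, …` (where `g 0 = g 1` by convention). -/
structure IsShape {n : ℕ} (π : Equiv.Perm (Fin n)) (g : ℕ → ℕ) : Prop where
  anti : Antitone g
  zero : g 0 = g 1
  mem_region : ∀ r c, (r, c) ∈ region π ↔
    1 ≤ r ∧ 1 ≤ c ∧ (r ≤ g (c - 1) ∨ r ≤ g c + 1) ∧ (c = 1 ∨ 1 ≤ g (c - 1))
  mem_bottom : ∀ r c, (r, c) ∈ bottomDream π ↔ 1 ≤ c ∧ 2 ≤ r ∧ r ≤ g c + 1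
  bounded : ∀ c, n ≤ c → g c = 0

/-- The column heights of the region together with its outer corners. -/
def height (g : ℕ → ℕ) (c : ℕ) : ℕ := g (c - 1) + 1

theorem height_succ (g : ℕ → ℕ) (c : ℕ) : height g (c + 1) = g c + 1 := rfl

theorem antitone_height {g : ℕ → ℕ} (hg : Antitone g) : Antitone (height g) := fun _ _ h =>
  Nat.add_le_add_right (hg (Nat.sub_le_sub_right h 1)) 1

theorem colLength_eq {S : Finset (ℕ × ℕ)} {c a b : ℕ}
    (h : ∀ r, (r, c) ∈ S ↔ a ≤ r ∧ r ≤ b) : colLength S c = b + 1 - a := by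
  have : S.filter (fun x => x.2 = c) = (Finset.Icc a b).image (fun r => (r, c)) := by
    ext ⟨r, c'⟩
    simp only [Finset.mem_filter, Finset.mem_image, Finset.mem_Icc, Prod.mk.injEq]
    constructor
    · rintro ⟨h1, rfl⟩
      exact ⟨r, (h r).1 h1, rfl, rfl⟩
    · rintro ⟨r', h1, rfl, rfl⟩
      exact ⟨(h _).2 h1, rfl⟩
  rw [colLength, this, Finset.card_image_of_injective _ fun x y hxy => by simpa using hxy,
    Nat.card_Icc]

theorem card_filter_le_of_imp {α : Type*} {s : Finset α} {p q : α → Prop} [DecidablePred p]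
    [DecidablePred q] (h : ∀ x ∈ s, p x → q x) : (s.filter p).card ≤ (s.filter q).card :=
  Finset.card_le_card fun x hx => by
    rw [Finset.mem_filter] at hx ⊢
    exact ⟨hx.1, h x hx.1 hx.2⟩

theorem card_filter_lt_of_imp {α : Type*} {s : Finset α} {p q : α → Prop} [DecidablePred p]
    [DecidablePred q] (h : ∀ x ∈ s, p x → q x) {y : α} (hy : y ∈ s) (hq : q y) (hp : ¬ p y) :
    (s.filter p).card < (s.filter q).card := by
  refine Finset.card_lt_card ((Finset.ssubset_iff_of_subset fun x hx => ?_).2 ⟨y, ?_, ?_⟩)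
  · rw [Finset.mem_filter] at hx ⊢
    exact ⟨hx.1, h x hx.1 hx.2⟩
  · exact Finset.mem_filter.2 ⟨hy, hq⟩
  · exact fun hy' => hp (Finset.mem_filter.1 hy').2

namespace IsShape

variable {n : ℕ} {π : Equiv.Perm (Fin n)} {g : ℕ → ℕ}

theorem le_pred (S : IsShape π g) (c : ℕ) : g c ≤ g (c - 1) := S.anti (Nat.sub_le c 1)

theorem region_mono (S : IsShape π g) {r c r' c' : ℕ} (h : (r, c) ∈ region π) (hr : 1 ≤ r')
    (hr' : r' ≤ r) (hc : 1 ≤ c') (hc' : c' ≤ c) : (r', c') ∈ region π := by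
  rw [S.mem_region] at h ⊢
  have h1 := S.anti hc'
  have h2 : g (c - 1) ≤ g (c' - 1) := S.anti (by omega)
  omega

theorem mem_cols (S : IsShape π g) {c : ℕ} :
    c ∈ cols π ↔ 1 ≤ c ∧ (c = 1 ∨ 1 ≤ g (c - 1)) := by
  simp only [cols, Finset.mem_image, Prod.exists, exists_eq_right, S.mem_region]
  constructor
  · rintro ⟨r, h⟩
    omega
  · intro h
    exact ⟨1, by omega⟩

theorem mem_rows (S : IsShape π g) {r : ℕ} : r ∈ rows π ↔ 1 ≤ r ∧ r ≤ g 1 + 1 := by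
  have key : r ∈ rows π ↔ (r, 1) ∈ region π := by
    simp only [rows, Finset.mem_image, Prod.exists, exists_and_right, exists_eq_right]
    constructor
    · rintro ⟨c, h⟩
      have := (S.mem_region r c).1 h
      exact S.region_mono h this.1 le_rfl le_rfl this.2.1
    · exact fun h => ⟨1, h⟩
  rw [key, S.mem_region]
  have h0 : g (1 - 1) = g 1 := S.zero
  rw [h0]
  constructor <;> intro h <;> omega

theorem mem_cols_of_mem (_ : IsShape π g) {r c : ℕ} (h : (r, c) ∈ region π) : c ∈ cols π :=
  Finset.mem_image_of_mem Prod.snd h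

theorem mem_rows_of_mem (_ : IsShape π g) {r c : ℕ} (h : (r, c) ∈ region π) : r ∈ rows π :=
  Finset.mem_image_of_mem Prod.fst h

theorem le_height (S : IsShape π g) {r c : ℕ} (h : (r, c) ∈ region π) : r ≤ height g c := by
  have := (S.mem_region r c).1 h
  have := S.le_pred c
  unfold height
  omega

theorem one_mem (S : IsShape π g) {c : ℕ} (hc : c ∈ cols π) : (1, c) ∈ region π := by
  rw [S.mem_cols] at hc
  rw [S.mem_region]
  omega

theorem mem_one (S : IsShape π g) {r : ℕ} (hr : r ∈ rows π) : (r, 1) ∈ region π := by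
  rw [S.mem_rows] at hr
  rw [S.mem_region]
  omega

theorem mem_region_iff (S : IsShape π g) {r c : ℕ} (hc : c ∈ cols π) :
    (r, c) ∈ region π ↔ 1 ≤ r ∧ r ≤ max (g (c - 1)) (g c + 1) := by
  rw [S.mem_cols] at hc
  rw [S.mem_region]
  omega

theorem colLength_region (S : IsShape π g) {c : ℕ} (hc : c ∈ cols π) :
    colLength (region π) c = max (g (c - 1)) (g c + 1) := by
  rw [colLength_eq fun r => S.mem_region_iff hc]
  omega

/-- Past column `1`: if `g c = g (c - 1)`, the column ends in the bottom dream and the box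
diagonally south-west is outside it. If `g c` is smaller by one, that box belongs to the bottom
dream; if smaller by more, the column itself ends outside it. -/
theorem eInA_iff (S : IsShape π g) {c : ℕ} (hc : c ∈ cols π) : EInA π c ↔ g c = g (c - 1) := by
  have h1 := S.le_pred c
  unfold EInA
  rw [S.colLength_region hc, S.mem_bottom, S.mem_bottom]
  rw [S.mem_cols] at hc
  rcases Nat.eq_or_lt_of_le hc.1 with rfl | h2
  · simp [S.zero]
  · omega

theorem eLabel_lt_nLabel (S : IsShape π g) {r c : ℕ} (h : (r, c) ∈ region π) :
    eLabel π c < nLabel π r := by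
  have hr := (S.mem_region r c).1 h
  refine Nat.add_lt_add_of_le_of_lt (card_filter_le_of_imp ?_)
    (card_filter_lt_of_imp (y := r) ?_ (S.mem_rows_of_mem h) le_rfl (by simpa using h))
  · rintro c' hc' ⟨h1, h2⟩
    exact ⟨S.region_mono h hr.1 le_rfl (S.mem_cols.1 hc').1 h1, h2⟩
  · intro r' hr' h1
    by_contra! h2
    exact h1 (S.region_mono h (S.mem_rows.1 hr').1 h2.le hr.2.1 le_rfl)

theorem nLabel_le_eLabel (S : IsShape π g) {r c : ℕ} (hr : r ∈ rows π) (hc : c ∈ cols π)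
    (h : (r, c) ∉ region π) : nLabel π r ≤ eLabel π c := by
  refine Nat.add_le_add (card_filter_le_of_imp ?_) (card_filter_le_of_imp ?_)
  · rintro c' hc' ⟨h1, h2⟩
    refine ⟨?_, h2⟩
    by_contra! h3
    exact h (S.region_mono h1 (S.mem_rows.1 hr).1 le_rfl (S.mem_cols.1 hc).1 h3.le)
  · intro r' hr' h1 h2
    exact h (S.region_mono h2 (S.mem_rows.1 hr).1 h1 (S.mem_cols.1 hc).1 le_rfl)

/-- The one coincidence of labels: an east step outside A copies the label of the north step just
before it, and the two meet at an outer corner. -/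
theorem nLabel_eq_eLabel_iff (S : IsShape π g) {r c : ℕ} (hr : r ∈ rows π) (hc : c ∈ cols π) :
    nLabel π r = eLabel π c ↔ (r, c) ∉ region π ∧ r = height g c := by
  have hrp := S.mem_rows.1 hr
  have hcp := S.mem_cols.1 hc
  have hlep := S.le_pred c
  constructor
  · intro h
    have hn : (r, c) ∉ region π := fun hm => by have := S.eLabel_lt_nLabel hm; omega
    refine ⟨hn, ?_⟩
    by_contra hne
    have hlt : g (c - 1) + 1 < r := by
      rw [S.mem_region_iff hc] at hn
      unfold height at hne
      omega
    have hle1 : ((cols π).filter (fun c' => (r, c') ∈ region π ∧ EInA π c')).card ≤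
        ((cols π).filter (fun c' => c' ≤ c ∧ EInA π c')).card := by
      refine card_filter_le_of_imp ?_
      rintro c' hc' ⟨h1, h2⟩
      refine ⟨?_, h2⟩
      by_contra! h3
      exact hn (S.region_mono h1 hrp.1 le_rfl hcp.1 h3.le)
    have hle2 : ((rows π).filter (fun r' => r ≤ r')).card ≤
        ((rows π).filter (fun r' => (r', c) ∉ region π)).card := by
      refine card_filter_le_of_imp ?_
      intro r' hr' h1 h2
      exact hn (S.region_mono h2 hrp.1 h1 hcp.1 le_rfl)
    refine h.not_lt ?_
    -- A step strictly between makes the count strict: the east step of `c` itself if it is in A,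
    -- and otherwise the north step of row `r - 1`, which is still below column `c`.
    by_cases hA : EInA π c
    · refine Nat.add_lt_add_of_lt_of_le (card_filter_lt_of_imp (y := c) ?_ hc ⟨le_rfl, hA⟩
        fun h1 => hn h1.1) hle2
      rintro c' hc' ⟨h1, h2⟩
      refine ⟨?_, h2⟩
      by_contra! h3
      exact hn (S.region_mono h1 hrp.1 le_rfl hcp.1 h3.le)
    · refine Nat.add_lt_add_of_le_of_lt hle1 (card_filter_lt_of_imp (y := r - 1) ?_ ?_ ?_ ?_)
      · intro r' hr' h1 h2
        exact hn (S.region_mono h2 hrp.1 h1 hcp.1 le_rfl)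
      · rw [S.mem_rows]
        omega
      · rw [S.eInA_iff hc] at hA
        rw [S.mem_region_iff hc]
        omega
      · omega
  · rintro ⟨hn, rfl⟩
    have hlt : g c < g (c - 1) := by
      rw [S.mem_region_iff hc] at hn
      unfold height at hn
      omega
    refine le_antisymm (S.nLabel_le_eLabel hr hc hn) ?_
    refine Nat.add_le_add (card_filter_le_of_imp ?_) (card_filter_le_of_imp ?_)
    · rintro c' hc' ⟨h1, h2⟩
      refine ⟨?_, h2⟩
      have hcc : c' ≠ c := by
        rintro rfl
        rw [S.eInA_iff hc] at h2
        omega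
      have : g (c - 1) ≤ g c' := S.anti (by omega)
      rw [S.mem_region_iff hc']
      unfold height
      omega
    · intro r' hr' h1
      rw [S.mem_region_iff hc] at h1
      have := S.mem_rows.1 hr'
      unfold height
      omega

theorem eLabel_lt (S : IsShape π g) {c c' : ℕ} (hc : c ∈ cols π) (hc' : c' ∈ cols π)
    (h : c < c') : eLabel π c < eLabel π c' := by
  have hcp := S.mem_cols.1 hc
  have hle1 : ∀ x ∈ cols π, x ≤ c ∧ EInA π x → x ≤ c' ∧ EInA π x :=
    fun x _ hx => ⟨hx.1.trans h.le, hx.2⟩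
  have hle2 : ∀ x ∈ rows π, (x, c) ∉ region π → (x, c') ∉ region π :=
    fun x hx h1 h2 => h1 (S.region_mono h2 (S.mem_rows.1 hx).1 le_rfl hcp.1 h.le)
  by_cases hA : EInA π c'
  · exact Nat.add_lt_add_of_lt_of_le (card_filter_lt_of_imp hle1 hc' ⟨le_rfl, hA⟩
      fun h1 => absurd h1.1 (by omega)) (card_filter_le_of_imp hle2)
  · have h1 := S.le_pred c'
    have h2 : g (c' - 1) ≤ g c := S.anti (by omega)
    rw [S.eInA_iff hc'] at hA
    -- When the later east step is not in A, the north step it copies separates the two labels.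
    have h3 : (height g c', c) ∈ region π := by
      rw [S.mem_region_iff hc]
      unfold height
      omega
    refine Nat.add_lt_add_of_le_of_lt (card_filter_le_of_imp hle1)
      (card_filter_lt_of_imp hle2 (S.mem_rows_of_mem h3) ?_ (by simpa using h3))
    rw [S.mem_region_iff hc']
    unfold height
    omega

theorem nLabel_lt (S : IsShape π g) {r r' : ℕ} (hr : r ∈ rows π) (h : r < r') :
    nLabel π r' < nLabel π r := by
  have hrp := S.mem_rows.1 hr
  refine Nat.add_lt_add_of_le_of_lt (card_filter_le_of_imp ?_)
    (card_filter_lt_of_imp (y := r) ?_ hr le_rfl (by omega))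
  · rintro c hc ⟨h1, h2⟩
    exact ⟨S.region_mono h1 hrp.1 h.le (S.mem_cols.1 hc).1 le_rfl, h2⟩
  · intro x _ hx
    omega

theorem eLabel_inj (S : IsShape π g) {c c' : ℕ} (hc : c ∈ cols π) (hc' : c' ∈ cols π)
    (h : eLabel π c = eLabel π c') : c = c' := by
  rcases lt_trichotomy c c' with h1 | h1 | h1
  · exact absurd h (S.eLabel_lt hc hc' h1).ne
  · exact h1
  · exact absurd h (S.eLabel_lt hc' hc h1).ne'

theorem nLabel_inj (S : IsShape π g) {r r' : ℕ} (hr : r ∈ rows π) (hr' : r' ∈ rows π)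
    (h : nLabel π r = nLabel π r') : r = r' := by
  rcases lt_trichotomy r r' with h1 | h1 | h1
  · exact absurd h (S.nLabel_lt hr h1).ne'
  · exact h1
  · exact absurd h (S.nLabel_lt hr' h1).ne

theorem one_mem_cols (S : IsShape π g) : 1 ∈ cols π := S.mem_cols.2 (by omega)

theorem eLabel_pos (S : IsShape π g) {c : ℕ} (hc : c ∈ cols π) : 1 ≤ eLabel π c := by
  refine le_add_right (Finset.card_pos.2 ⟨1, Finset.mem_filter.2 ⟨S.one_mem_cols, ?_, Or.inl rfl⟩⟩)
  exact (S.mem_cols.1 hc).1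

theorem nLabel_le (π : Equiv.Perm (Fin n)) (r : ℕ) : nLabel π r ≤ numVertices π :=
  Nat.add_le_add (card_filter_le_of_imp fun _ _ h => h.2) (Finset.card_filter_le _ _)

theorem eLabel_le (S : IsShape π g) {c : ℕ} (hc : c ∈ cols π) : eLabel π c ≤ numVertices π :=
  (S.eLabel_lt_nLabel (S.one_mem hc)).le.trans (nLabel_le π 1)

theorem nLabel_pos (S : IsShape π g) {r : ℕ} (hr : r ∈ rows π) : 1 ≤ nLabel π r :=
  (S.eLabel_pos S.one_mem_cols).trans (S.eLabel_lt_nLabel (S.mem_one hr)).le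

theorem eLabel_one (S : IsShape π g) : eLabel π 1 = 1 := by
  have h1 : (cols π).filter (fun c' => c' ≤ 1 ∧ EInA π c') = {1} := by
    ext x
    simp only [Finset.mem_filter, Finset.mem_singleton]
    constructor
    · rintro ⟨h1, h2, -⟩
      have := (S.mem_cols.1 h1).1
      omega
    · rintro rfl
      exact ⟨S.one_mem_cols, le_rfl, Or.inl rfl⟩
  have h2 : (rows π).filter (fun r => (r, 1) ∉ region π) = ∅ :=
    Finset.filter_eq_empty_iff.2 fun r hr => not_not.2 (S.mem_one hr)
  rw [eLabel, h1, h2]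
  rfl

theorem nLabel_one (S : IsShape π g) : nLabel π 1 = numVertices π := by
  refine le_antisymm (nLabel_le π 1) (Nat.add_le_add (card_filter_le_of_imp ?_) ?_)
  · exact fun c hc h => ⟨S.one_mem hc, h⟩
  · rw [Finset.filter_true_of_mem fun r hr => (S.mem_rows.1 hr).1]

/-- Every vertex is the label of an `E` step or of an `N` step. -/
theorem exists_label (S : IsShape π g) {v : ℕ} (hv : 1 ≤ v) (hv' : v ≤ numVertices π) :
    (∃ c ∈ cols π, eLabel π c = v) ∨ ∃ r ∈ rows π, nLabel π r = v := by
  set X := ((cols π).filter (fun c => EInA π c)).image (eLabel π)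
  set Y := (rows π).image (nLabel π)
  have hX : X.card = ((cols π).filter (fun c => EInA π c)).card :=
    Finset.card_image_of_injOn fun c hc c' hc' h =>
      S.eLabel_inj (Finset.mem_filter.1 hc).1 (Finset.mem_filter.1 hc').1 h
  have hY : Y.card = (rows π).card :=
    Finset.card_image_of_injOn fun r hr r' hr' h => S.nLabel_inj hr hr' h
  have hd : Disjoint X Y := by
    rw [Finset.disjoint_left]
    intro x hx hy
    obtain ⟨c, hc, rfl⟩ := Finset.mem_image.1 hx
    obtain ⟨r, hr, h⟩ := Finset.mem_image.1 hy
    obtain ⟨hc, hA⟩ := Finset.mem_filter.1 hc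
    obtain ⟨h1, rfl⟩ := (S.nLabel_eq_eLabel_iff hr hc).1 h
    rw [S.eInA_iff hc] at hA
    rw [S.mem_region_iff hc] at h1
    unfold height at h1
    omega
  have hsub : X ∪ Y ⊆ Finset.Icc 1 (numVertices π) := by
    intro x hx
    rw [Finset.mem_Icc]
    rcases Finset.mem_union.1 hx with hx | hx
    · obtain ⟨c, hc, rfl⟩ := Finset.mem_image.1 hx
      have hc := (Finset.mem_filter.1 hc).1
      exact ⟨S.eLabel_pos hc, S.eLabel_le hc⟩
    · obtain ⟨r, hr, rfl⟩ := Finset.mem_image.1 hx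
      exact ⟨S.nLabel_pos hr, nLabel_le π r⟩
  -- East steps in A and north steps carry distinct labels, `m` in number, so they exhaust the
  -- vertices.
  have hcard : (Finset.Icc 1 (numVertices π)).card ≤ (X ∪ Y).card := by
    rw [Finset.card_union_of_disjoint hd, hX, hY, Nat.card_Icc, numVertices]
    omega
  have hmem : v ∈ X ∪ Y := by
    rw [Finset.eq_of_subset_of_card_le hsub hcard]
    exact Finset.mem_Icc.2 ⟨hv, hv'⟩
  rcases Finset.mem_union.1 hmem with h | h
  · obtain ⟨c, hc, h⟩ := Finset.mem_image.1 h
    exact Or.inl ⟨c, (Finset.mem_filter.1 hc).1, h⟩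
  · obtain ⟨r, hr, h⟩ := Finset.mem_image.1 h
    exact Or.inr ⟨r, hr, h⟩

/-- The bottom dream occupies `g c` boxes of column `c`, so the dropped dots leave exactly the top
`g c` boxes free. -/
theorem mem_droppedDots (S : IsShape π g) {r c : ℕ} :
    (r, c) ∈ droppedDots π ↔ (r, c) ∈ region π ∧ g c < r := by
  rw [droppedDots, Finset.mem_filter]
  refine and_congr_right fun h => ?_
  have hc := S.mem_cols_of_mem h
  have hrc := (S.mem_region_iff hc).1 h
  have hcp := S.mem_cols.1 hc
  have h1 : ((region π).filter (fun b' => b'.2 = (r, c).2 ∧ (r, c).1 < b'.1)).card =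
      max (g (c - 1)) (g c + 1) + 1 - (r + 1) := by
    rw [← colLength_eq (S := (region π).filter (fun b' => r < b'.1)) (c := c), colLength,
      Finset.filter_filter]
    · congr 1
      refine Finset.filter_congr fun b _ => ?_
      exact and_comm
    · intro q
      rw [Finset.mem_filter, S.mem_region_iff hc]
      omega
  have h2 : colLength (region π \ bottomDream π) c + colLength (bottomDream π) c =
      colLength (region π) c := by
    have hsub : bottomDream π ⊆ region π := fun b hb =>
      Finset.mem_insert_of_mem (Finset.mem_union_left _ hb)
    unfold colLength
    rw [← Finset.card_union_of_disjoint, ← Finset.filter_union, Finset.sdiff_union_of_subset hsub]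
    exact Finset.disjoint_filter_filter Finset.sdiff_disjoint
  have h3 : colLength (bottomDream π) c = g c + 1 + 1 - 2 :=
    colLength_eq fun q => by rw [S.mem_bottom]; omega
  rw [h1]
  rw [h3, S.colLength_region hc] at h2
  simp only
  omega

end IsShape

/-! ### Noncrossing alternating graphs -/

/-- Take a shortest edge ab of a cycle, a < b. By alternation the other cycle edges at a and b go to
some x > a and y < b; by minimality y < a < b < x, so they cross. -/
theorem IsNoncrossing.isAcyclic {m : ℕ} {F : SimpleGraph (Fin m)} (hn : IsNoncrossing F)
    (ha : IsAlternating F) : F.IsAcyclic := by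
  intro v w hw
  have hadj : ∀ {a b}, w.toSubgraph.Adj a b → F.Adj a b := fun h => h.adj_sub
  have hother : ∀ {a b}, w.toSubgraph.Adj a b → ∃ x, w.toSubgraph.Adj a x ∧ x ≠ b := by
    intro a b h
    have h2 := hw.ncard_neighborSet_toSubgraph_eq_two (w.mem_verts_toSubgraph.1 h.fst_mem)
    obtain ⟨x, hx, hxb⟩ := Set.exists_ne_of_one_lt_ncard (s := w.toSubgraph.neighborSet a)
      (by omega) b
    exact ⟨x, hx, hxb⟩
  have hne : {p : Fin m × Fin m | p.1 < p.2 ∧ w.toSubgraph.Adj p.1 p.2}.Nonempty := by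
    have h1 := w.toSubgraph_adj_snd hw.not_nil
    rcases lt_or_gt_of_ne (hadj h1).ne with h2 | h2
    · exact ⟨(_, _), h2, h1⟩
    · exact ⟨(_, _), h2, h1.symm⟩
  obtain ⟨⟨a, b⟩, ⟨hab, hAB⟩, hmin⟩ :=
    (measure fun p : Fin m × Fin m => (p.2 : ℕ) - p.1).wf.has_min _ hne
  simp only at hab hAB
  obtain ⟨x, hax, hxb⟩ := hother hAB
  obtain ⟨y, hby, hya⟩ := hother hAB.symm
  have h1 : a < x := by
    rcases lt_or_gt_of_ne (hadj hax).ne with h | h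
    · exact h
    · exact absurd ⟨hadj hax.symm, hadj hAB⟩ (ha x a b h hab)
  have h2 : y < b := by
    rcases lt_or_gt_of_ne (hadj hby).ne with h | h
    · exact absurd ⟨hadj hAB, hadj hby⟩ (ha a b y hab h)
    · exact h
  have h3 := hmin (a, x) ⟨h1, hax⟩
  have h4 := hmin (y, b) ⟨h2, hby.symm⟩
  simp only [WellFoundedRelation.rel, InvImage, not_lt] at h3 h4
  have hab' : (a : ℕ) < b := hab
  have h1' : (a : ℕ) < x := h1
  have h2' : (y : ℕ) < b := h2
  have hxb' : (x : ℕ) ≠ b := fun h => hxb (Fin.ext h)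
  have hya' : (y : ℕ) ≠ a := fun h => hya (Fin.ext h)
  refine hn y a b x ?_ hab ?_ ⟨hadj hby.symm, hadj hax⟩
  · exact Fin.lt_def.2 (by omega)
  · exact Fin.lt_def.2 (by omega)

theorem graph_eq_of_lt {m : ℕ} {F G : SimpleGraph (Fin m)}
    (h : ∀ u v, u < v → (F.Adj u v ↔ G.Adj u v)) : F = G := by
  ext u v
  rcases lt_trichotomy u v with h1 | rfl | h1
  · exact h u v h1
  · simp
  · rw [F.adj_comm, G.adj_comm]
    exact h v u h1

/-- No two boxes of `S` lie in north-east to south-west position within the shape with column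
heights `height g`. -/
def IsFilling (g : ℕ → ℕ) (S : Finset (ℕ × ℕ)) : Prop :=
  ∀ r c r' c', (r, c) ∈ S → (r', c') ∈ S → r < r' → c' < c → height g c < r'

namespace IsShape

variable {n : ℕ} {π : Equiv.Perm (Fin n)} {g : ℕ → ℕ}

theorem exists_eVertex (S : IsShape π g) {c : ℕ} (hc : c ∈ cols π) :
    ∃ u : Fin (numVertices π), eLabel π c = (u : ℕ) + 1 := by
  have h1 := S.eLabel_pos hc
  have h2 := S.eLabel_le hc
  exact ⟨⟨eLabel π c - 1, by omega⟩, by simp only; omega⟩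

theorem exists_nVertex (S : IsShape π g) {r : ℕ} (hr : r ∈ rows π) :
    ∃ u : Fin (numVertices π), nLabel π r = (u : ℕ) + 1 := by
  have h1 := S.nLabel_pos hr
  have h2 := nLabel_le π r
  exact ⟨⟨nLabel π r - 1, by omega⟩, by simp only; omega⟩

theorem lt_of_eLabel_lt (S : IsShape π g) {c c' : ℕ} (hc : c ∈ cols π) (hc' : c' ∈ cols π)
    (h : eLabel π c < eLabel π c') : c < c' := by
  by_contra! hle
  rcases Nat.eq_or_lt_of_le hle with rfl | h1
  · omega
  · have := S.eLabel_lt hc' hc h1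
    omega

theorem lt_of_nLabel_lt (S : IsShape π g) {r r' : ℕ} (hr : r ∈ rows π)
    (h : nLabel π r < nLabel π r') : r' < r := by
  by_contra! hle
  rcases Nat.eq_or_lt_of_le hle with rfl | h1
  · omega
  · have := S.nLabel_lt hr h1
    omega

theorem mem_region_of_label_lt (S : IsShape π g) {r c : ℕ} (hr : r ∈ rows π) (hc : c ∈ cols π)
    (h : eLabel π c < nLabel π r) : (r, c) ∈ region π := by
  by_contra hn
  have := S.nLabel_le_eLabel hr hc hn
  omega

theorem boxGraph_adj (S : IsShape π g) {E : Finset (ℕ × ℕ)} (hE : E ⊆ region π)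
    {u v : Fin (numVertices π)} (huv : u < v) :
    (boxGraph π E).Adj u v ↔
      ∃ r c, (r, c) ∈ E ∧ eLabel π c = (u : ℕ) + 1 ∧ nLabel π r = (v : ℕ) + 1 := by
  rw [boxGraph, SimpleGraph.fromRel_adj]
  have huv' : (u : ℕ) < v := huv
  constructor
  · rintro ⟨-, ⟨⟨r, c⟩, h1, h2, h3⟩ | ⟨⟨r, c⟩, h1, h2, h3⟩⟩
    · exact ⟨r, c, h1, h2, h3⟩
    · have := S.eLabel_lt_nLabel (hE h1)
      simp only at h2 h3
      omega
  · rintro ⟨r, c, h1, h2, h3⟩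
    exact ⟨huv.ne, Or.inl ⟨(r, c), h1, h2, h3⟩⟩

theorem boxGraph_adj_of_mem (S : IsShape π g) {E : Finset (ℕ × ℕ)} (hE : E ⊆ region π) {r c : ℕ}
    (h : (r, c) ∈ E) {u v : Fin (numVertices π)} (hu : eLabel π c = (u : ℕ) + 1)
    (hv : nLabel π r = (v : ℕ) + 1) : (boxGraph π E).Adj u v := by
  have h1 := S.eLabel_lt_nLabel (hE h)
  exact (S.boxGraph_adj hE (Fin.lt_def.2 (by omega))).2 ⟨r, c, h, hu, hv⟩

theorem mem_of_boxGraph_adj (S : IsShape π g) {E : Finset (ℕ × ℕ)} (hE : E ⊆ region π) {r c : ℕ}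
    (h : (r, c) ∈ region π) {u v : Fin (numVertices π)} (hu : eLabel π c = (u : ℕ) + 1)
    (hv : nLabel π r = (v : ℕ) + 1) (hadj : (boxGraph π E).Adj u v) : (r, c) ∈ E := by
  have h1 := S.eLabel_lt_nLabel h
  obtain ⟨r', c', h2, h3, h4⟩ := (S.boxGraph_adj hE (Fin.lt_def.2 (by omega))).1 hadj
  obtain rfl := S.eLabel_inj (S.mem_cols_of_mem (hE h2)) (S.mem_cols_of_mem h) (h3.trans hu.symm)
  obtain rfl := S.nLabel_inj (S.mem_rows_of_mem (hE h2)) (S.mem_rows_of_mem h) (h4.trans hv.symm)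
  exact h2

theorem boxGraph_injOn (S : IsShape π g) {E E' : Finset (ℕ × ℕ)} (hE : E ⊆ region π)
    (hE' : E' ⊆ region π) (h : boxGraph π E ≤ boxGraph π E') : E ⊆ E' := by
  rintro ⟨r, c⟩ hm
  obtain ⟨u, hu⟩ := S.exists_eVertex (S.mem_cols_of_mem (hE hm))
  obtain ⟨v, hv⟩ := S.exists_nVertex (S.mem_rows_of_mem (hE hm))
  exact S.mem_of_boxGraph_adj hE' (hE hm) hu hv (h (S.boxGraph_adj_of_mem hE hm hu hv))

theorem eq_height (S : IsShape π g) {r c : ℕ} (hc : c ∈ cols π) (hr : 1 ≤ r)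
    (hrc : r ≤ height g c) (h : (r, c) ∉ region π) : r = height g c := by
  rw [S.mem_region_iff hc] at h
  unfold height at hrc ⊢
  omega

theorem isFilling_of_boxGraph (S : IsShape π g) {E : Finset (ℕ × ℕ)} (hE : E ⊆ region π)
    (hn : IsNoncrossing (boxGraph π E)) (ha : IsAlternating (boxGraph π E)) : IsFilling g E := by
  intro r c r' c' h h' hr hc
  by_contra! hle
  have hC := S.mem_cols_of_mem (hE h)
  have hC' := S.mem_cols_of_mem (hE h')
  have hR := S.mem_rows_of_mem (hE h)
  have hR' := S.mem_rows_of_mem (hE h')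
  obtain ⟨i, hi⟩ := S.exists_eVertex hC'
  obtain ⟨j, hj⟩ := S.exists_eVertex hC
  obtain ⟨k, hk⟩ := S.exists_nVertex hR'
  obtain ⟨l, hl⟩ := S.exists_nVertex hR
  have h1 := S.eLabel_lt hC' hC hc
  have h2 := S.nLabel_lt hR hr
  have h3 := S.boxGraph_adj_of_mem hE h hj hl
  have h4 := S.boxGraph_adj_of_mem hE h' hi hk
  -- The south-east box of the pair decides: inside R(π) the two edges cross, at an outer corner
  -- they share a vertex that violates alternation.
  by_cases hm : (r', c) ∈ region π
  · have h5 := S.eLabel_lt_nLabel hm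
    exact hn i j k l (Fin.lt_def.2 (by omega)) (Fin.lt_def.2 (by omega))
      (Fin.lt_def.2 (by omega)) ⟨h4, h3⟩
  · have h5 := (S.nLabel_eq_eLabel_iff hR' hC).2 ⟨hm, S.eq_height hC (by omega) hle hm⟩
    obtain rfl : j = k := Fin.ext (by omega)
    exact ha i j l (Fin.lt_def.2 (by omega)) (Fin.lt_def.2 (by omega)) ⟨h4, h3⟩

theorem isNoncrossing_boxGraph (S : IsShape π g) {E : Finset (ℕ × ℕ)} (hE : E ⊆ region π)
    (hF : IsFilling g E) : IsNoncrossing (boxGraph π E) := by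
  rintro i j k l hij hjk hkl ⟨h1, h2⟩
  obtain ⟨r', c', h', hi, hk⟩ := (S.boxGraph_adj hE (hij.trans hjk)).1 h1
  obtain ⟨r, c, h, hj, hl⟩ := (S.boxGraph_adj hE (hjk.trans hkl)).1 h2
  have hC := S.mem_cols_of_mem (hE h)
  have hR' := S.mem_rows_of_mem (hE h')
  rw [Fin.lt_def] at hij hjk hkl
  have hr := S.lt_of_nLabel_lt (r := r') (r' := r) hR' (by omega)
  have hc := S.lt_of_eLabel_lt (S.mem_cols_of_mem (hE h')) hC (by omega)
  have hm := S.mem_region_of_label_lt hR' hC (by omega)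
  have := S.le_height hm
  have := hF r c r' c' h h' hr hc
  omega

theorem isAlternating_boxGraph (S : IsShape π g) {E : Finset (ℕ × ℕ)} (hE : E ⊆ region π)
    (hF : IsFilling g E) : IsAlternating (boxGraph π E) := by
  rintro i j k hij hjk ⟨h1, h2⟩
  obtain ⟨r', c', h', hi, hj'⟩ := (S.boxGraph_adj hE hij).1 h1
  obtain ⟨r, c, h, hj, hk⟩ := (S.boxGraph_adj hE hjk).1 h2
  have hC := S.mem_cols_of_mem (hE h)
  have hR' := S.mem_rows_of_mem (hE h')
  rw [Fin.lt_def] at hij hjk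
  have hr := S.lt_of_nLabel_lt (r := r') (r' := r) hR' (by omega)
  have hc := S.lt_of_eLabel_lt (S.mem_cols_of_mem (hE h')) hC (by omega)
  have := ((S.nLabel_eq_eLabel_iff hR' hC).1 (hj'.trans hj.symm)).2
  have := hF r c r' c' h h' hr hc
  omega

/-! ### The directed transitive closure of `T(π)` -/

/-- If the box has no dot, go from column `c` along its highest dot, in row `g c + 1`. That row ends
at an outer corner, in the first column `q` with `g q < g c`, so the edge arrives at the label of
column `q`; continue from the box `(r, q)`. -/
theorem transGen_tree (S : IsShape π g) {r c : ℕ} (h : (r, c) ∈ region π)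
    {u v : Fin (numVertices π)} (hu : eLabel π c = (u : ℕ) + 1) (hv : nLabel π r = (v : ℕ) + 1) :
    Relation.TransGen (fun u v => u < v ∧ (tree π).Adj u v) u v := by
  have hdots : droppedDots π ⊆ region π := Finset.filter_subset _ _
  have hedge : ∀ {r c : ℕ} {u v : Fin (numVertices π)}, (r, c) ∈ region π → g c < r →
      eLabel π c = (u : ℕ) + 1 → nLabel π r = (v : ℕ) + 1 → u < v ∧ (tree π).Adj u v := by
    intro r c u v h hg hu hv
    refine ⟨?_, S.boxGraph_adj_of_mem hdots (S.mem_droppedDots.2 ⟨h, hg⟩) hu hv⟩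
    have := S.eLabel_lt_nLabel h
    exact Fin.lt_def.2 (by omega)
  induction hd : n - c using Nat.strong_induction_on generalizing c u with
  | _ d ih =>
    by_cases hg : g c < r
    · exact .single (hedge h hg hu hv)
    · push Not at hg
      have hrc := (S.mem_region r c).1 h
      have hlep := S.le_pred c
      -- `g` vanishes from `n` on, and `g c` is positive here.
      have hex : ∃ q, c < q ∧ g q < g c :=
        ⟨max n (c + 1), by omega, by rw [S.bounded _ (le_max_left _ _)]; omega⟩
      obtain ⟨hq1, hq2⟩ := Nat.find_spec hex
      have hq3 : g (Nat.find hex - 1) = g c := by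
        refine le_antisymm (S.anti (by omega)) ?_
        rcases Nat.eq_or_lt_of_le (show c ≤ Nat.find hex - 1 by omega) with h1 | h1
        · rw [← h1]
        · by_contra! h2
          exact Nat.find_min hex (m := Nat.find hex - 1) (by omega) ⟨h1, h2⟩
      generalize Nat.find hex = q at hq1 hq2 hq3
      have hc := S.mem_cols_of_mem h
      have hq : q ∈ cols π := by
        rw [S.mem_cols]
        omega
      have hp : (g c + 1, c) ∈ region π := by
        rw [S.mem_region_iff hc]
        omega
      have hrq : (r, q) ∈ region π := by
        rw [S.mem_region_iff hq]
        omega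
      have heq : nLabel π (g c + 1) = eLabel π q := by
        rw [S.nLabel_eq_eLabel_iff (S.mem_rows_of_mem hp) hq, S.mem_region_iff hq]
        unfold height
        omega
      have hcn : c < n := by
        by_contra! hle
        have := S.bounded c hle
        omega
      obtain ⟨w, hw⟩ := S.exists_eVertex hq
      exact .head (hedge hp (by omega) hu (heq.trans hw)) (ih (n - q) (by omega) hrq hw rfl)

/-- An increasing path starts at the label of an east step and ends at that of a north step; the
former being smaller, the corresponding box lies in R(π). -/
theorem dirTransClosure_tree (S : IsShape π g) :
    dirTransClosure (tree π) = boxGraph π (region π) := by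
  have hdots : droppedDots π ⊆ region π := Finset.filter_subset _ _
  have hlt : ∀ {u v : Fin (numVertices π)},
      Relation.TransGen (fun u v => u < v ∧ (tree π).Adj u v) u v → u < v := by
    intro u v h
    induction h with
    | single h => exact h.1
    | tail _ h ih => exact ih.trans h.1
  refine graph_eq_of_lt fun u v huv => ?_
  rw [dirTransClosure, SimpleGraph.fromRel_adj, S.boxGraph_adj subset_rfl huv]
  constructor
  · rintro ⟨-, h | h⟩
    · obtain ⟨w, ⟨h1, h2⟩, -⟩ := Relation.TransGen.head'_iff.1 h
      obtain ⟨w', -, h3, h4⟩ := Relation.TransGen.tail'_iff.1 h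
      obtain ⟨r', c, h5, h6, -⟩ := (S.boxGraph_adj hdots h1).1 h2
      obtain ⟨r, c', h7, -, h8⟩ := (S.boxGraph_adj hdots h3).1 h4
      rw [Fin.lt_def] at huv
      exact ⟨r, c, S.mem_region_of_label_lt (S.mem_rows_of_mem (hdots h7))
        (S.mem_cols_of_mem (hdots h5)) (by omega), h6, h8⟩
    · exact absurd (hlt h) huv.not_gt
  · rintro ⟨r, c, h1, h2, h3⟩
    exact ⟨huv.ne, Or.inl (S.transGen_tree h1 h2 h3)⟩

/-! ### From maximal fillings to trees -/

theorem height_pos (g : ℕ → ℕ) (c : ℕ) : 1 ≤ height g c := Nat.le_add_left 1 _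

theorem subset_region (S : IsShape π g) {C : Finset (ℕ × ℕ)}
    (hC : IsMaximalFilling (height g) C) : C ⊆ region π := by
  rintro ⟨r, c⟩ hm
  obtain ⟨hr, hc⟩ := hC.pos r c hm
  rw [S.mem_region]
  have hcov := hC.covered c hc r
  rw [height_succ] at hcov
  rcases Nat.eq_or_lt_of_le hc with rfl | hc1
  · have : ¬ g 1 + 1 < r := fun h => covered_one.1 (hcov h) hm
    omega
  · obtain ⟨d, rfl⟩ : ∃ d, c = d + 1 := ⟨c - 1, by omega⟩
    obtain ⟨t, ht, hcol⟩ := hC.column d (by omega)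
    have htpos := ht.pos
    have htle := ht.le
    have hne : t ≠ r := by
      rintro rfl
      exact hcol.elbow hm
    have hle : r ≤ height g (d + 1) := by
      by_contra! h
      exact hcol.below r h hm
    rw [height_succ] at hle htle
    -- An outer corner cannot be a cross: its row ends here, hence would be covered earlier, and
    -- then `t` would be this row, which has an elbow.
    have h2 : r = g d + 1 → r ≤ g (d + 1) + 1 := by
      intro h3
      by_contra! h4
      have h5 := (covered_succ (hcov h4)).resolve_right (not_not.2 hm)
      exact ht.max r (by omega) (by rw [height_succ]; omega) h5
    simp only [Nat.add_sub_cancel]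
    omega

theorem isFilling_elbows {C : Finset (ℕ × ℕ)} (hC : IsMaximalFilling (height g) C)
    (S : IsShape π g) : IsFilling g (region π \ C) := by
  intro r c r' c' h h' hr hc
  rw [Finset.mem_sdiff] at h h'
  have hp := (S.mem_region _ _).1 h.1
  have hp' := (S.mem_region _ _).1 h'.1
  obtain ⟨d, rfl⟩ : ∃ d, c = d + 1 := ⟨c - 1, by omega⟩
  obtain ⟨t, ht, hcol⟩ := hC.column d (by omega)
  have htr : t ≤ r := by
    by_contra! hlt
    exact h.2 (hcol.above r hp.1 hlt)
  by_contra! hle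
  exact ht.max r' (by omega) hle ⟨c', hp'.2.1, by omega, h'.2⟩

/-- Outer corners count as elbows: the labels of their row and column are the same vertex. -/
theorem reachable_of_elbow (S : IsShape π g) {C : Finset (ℕ × ℕ)} {r c : ℕ} (hc : c ∈ cols π)
    (hr : 1 ≤ r) (hrc : r ≤ height g c) (h : (r, c) ∉ C) {u v : Fin (numVertices π)}
    (hu : eLabel π c = (u : ℕ) + 1) (hv : nLabel π r = (v : ℕ) + 1) :
    (boxGraph π (region π \ C)).Reachable u v := by
  by_cases hm : (r, c) ∈ region π
  · exact (S.boxGraph_adj_of_mem Finset.sdiff_subset (Finset.mem_sdiff.2 ⟨hm, h⟩) hu hv).reachable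
  · have hrow : r ∈ rows π := by
      have h1 : g (c - 1) ≤ g 0 := S.anti (Nat.zero_le _)
      have h2 := S.zero
      rw [S.mem_rows]
      unfold height at hrc
      omega
    have := (S.nLabel_eq_eLabel_iff hrow hc).2 ⟨hm, S.eq_height hc hr hrc hm⟩
    obtain rfl : u = v := Fin.ext (by omega)
    rfl

/-- Column `d + 1` has an elbow in row `t`, and so has an earlier column; induction joins all
columns to the first. Each row has an elbow before it ends, which joins it to a column. -/
theorem connected_boxGraph (S : IsShape π g) {C : Finset (ℕ × ℕ)}
    (hC : IsMaximalFilling (height g) C) : (boxGraph π (region π \ C)).Connected := by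
  obtain ⟨v₀, hv₀⟩ := S.exists_eVertex S.one_mem_cols
  have hrow : ∀ {r c : ℕ}, 1 ≤ r → r ≤ height g c → r ∈ rows π := by
    intro r c hr hrc
    have h1 : g (c - 1) ≤ g 0 := S.anti (Nat.zero_le _)
    have h2 := S.zero
    rw [S.mem_rows]
    unfold height at hrc
    omega
  have hcols : ∀ c, c ∈ cols π → ∀ u : Fin (numVertices π), eLabel π c = (u : ℕ) + 1 →
      (boxGraph π (region π \ C)).Reachable v₀ u := by
    intro c
    induction c using Nat.strong_induction_on with
    | _ c ih =>
      intro hc u hu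
      have hcp := S.mem_cols.1 hc
      rcases Nat.eq_or_lt_of_le hcp.1 with rfl | hc1
      · obtain rfl : v₀ = u := Fin.ext (by omega)
        rfl
      · obtain ⟨d, rfl⟩ : ∃ d, c = d + 1 := ⟨c - 1, by omega⟩
        obtain ⟨t, ht, hcol⟩ := hC.column d (by omega)
        obtain ⟨c', h1, h2, h3⟩ := ht.covered
        have hc' : c' ∈ cols π :=
          S.mem_cols_of_mem (S.region_mono (S.one_mem hc) le_rfl le_rfl h1 (by omega))
        obtain ⟨w, hw⟩ := S.exists_nVertex (hrow ht.pos ht.le)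
        obtain ⟨x, hx⟩ := S.exists_eVertex hc'
        exact ((ih c' (by omega) hc' x hx).trans (S.reachable_of_elbow hc' ht.pos
          (ht.le.trans (antitone_height S.anti (by omega))) h3 hx hw)).trans
          (S.reachable_of_elbow hc ht.pos ht.le hcol.elbow hu hw).symm
  have hrows : ∀ r, r ∈ rows π → ∀ v : Fin (numVertices π), nLabel π r = (v : ℕ) + 1 →
      (boxGraph π (region π \ C)).Reachable v₀ v := by
    intro r hr v hv
    have hrp := S.mem_rows.1 hr
    rcases Nat.eq_or_lt_of_le hrp.1 with rfl | hr1
    · exact S.reachable_of_elbow S.one_mem_cols le_rfl (height_pos g 1) hC.corner hv₀ hv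
    -- The heights eventually drop to `1 < r`; the least such `c` is the last column of the shape
    -- meeting row `r`.
    · have hex : ∃ c, 1 ≤ c ∧ height g (c + 1) < r :=
        ⟨n + 1, by omega, by rw [height_succ, S.bounded _ (by omega)]; omega⟩
      obtain ⟨h1, h2⟩ := Nat.find_spec hex
      have h3 : r ≤ height g (Nat.find hex) := by
        rcases Nat.eq_or_lt_of_le h1 with h4 | h4
        · rw [← h4]
          have := S.zero
          unfold height
          rw [Nat.sub_self]
          omega
        · by_contra! h5
          refine Nat.find_min hex (m := Nat.find hex - 1) (by omega) ⟨by omega, ?_⟩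
          rwa [Nat.sub_add_cancel h1]
      obtain ⟨c', h4, h5, h6⟩ := hC.covered _ h1 r h2
      have h7 : r ≤ height g c' := h3.trans (antitone_height S.anti h5)
      have hc' : c' ∈ cols π := by
        rw [S.mem_cols]
        unfold height at h7
        omega
      obtain ⟨x, hx⟩ := S.exists_eVertex hc'
      exact (hcols c' hc' x hx).trans (S.reachable_of_elbow hc' hrp.1 h7 h6 hx hv)
  rw [SimpleGraph.connected_iff_exists_forall_reachable]
  refine ⟨v₀, fun w => ?_⟩
  rcases S.exists_label (v := (w : ℕ) + 1) (by omega) w.isLt with ⟨c, hc, h⟩ | ⟨r, hr, h⟩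
  · exact hcols c hc w h
  · exact hrows r hr w h

/-- The edge (1,m) already belongs to the box `(1, 1)`, which is an elbow. -/
theorem mapM_eq (S : IsShape π g) {C : Finset (ℕ × ℕ)} (hC : (1, 1) ∉ C) :
    mapM π C = boxGraph π (region π \ C) := by
  rw [mapM, sup_eq_left]
  have hmem : (1, 1) ∈ region π \ C :=
    Finset.mem_sdiff.2 ⟨S.one_mem S.one_mem_cols, hC⟩
  have key : ∀ u v : Fin (numVertices π), (u : ℕ) + 1 = 1 ∧ (v : ℕ) + 1 = numVertices π →
      (boxGraph π (region π \ C)).Adj u v := fun u v h =>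
    S.boxGraph_adj_of_mem Finset.sdiff_subset hmem (S.eLabel_one.trans h.1.symm)
      (S.nLabel_one.trans h.2.symm)
  intro u v h
  rw [SimpleGraph.fromRel_adj] at h
  rcases h.2 with h | h
  · exact key u v h
  · exact (key v u h).symm

theorem boxGraph_mem_ncAltSpanningTrees (S : IsShape π g) {C : Finset (ℕ × ℕ)}
    (hC : IsMaximalFilling (height g) C) :
    boxGraph π (region π \ C) ∈ ncAltSpanningTrees (dirTransClosure (tree π)) := by
  have hsub : region π \ C ⊆ region π := Finset.sdiff_subset
  have hF := isFilling_elbows hC S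
  have hn := S.isNoncrossing_boxGraph hsub hF
  have ha := S.isAlternating_boxGraph hsub hF
  refine ⟨?_, ⟨S.connected_boxGraph hC, hn.isAcyclic ha⟩, hn, ha⟩
  rw [S.dirTransClosure_tree]
  intro u v h
  rw [boxGraph, SimpleGraph.fromRel_adj] at h ⊢
  refine ⟨h.1, h.2.imp ?_ ?_⟩ <;>
  · rintro ⟨b, h1, h2⟩
    exact ⟨b, hsub h1, h2⟩

/-! ### From trees to maximal fillings -/

theorem exists_boxGraph_eq (S : IsShape π g) {F : SimpleGraph (Fin (numVertices π))}
    (hF : F ≤ dirTransClosure (tree π)) : ∃ E, E ⊆ region π ∧ boxGraph π E = F := by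
  classical
  set E := (region π).filter fun b => ∃ u v : Fin (numVertices π),
    eLabel π b.2 = (u : ℕ) + 1 ∧ nLabel π b.1 = (v : ℕ) + 1 ∧ F.Adj u v
  have hE : E ⊆ region π := Finset.filter_subset _ _
  refine ⟨E, hE, graph_eq_of_lt fun u v huv => ?_⟩
  rw [S.boxGraph_adj hE huv]
  constructor
  · rintro ⟨r, c, h1, h2, h3⟩
    obtain ⟨-, u', v', h4, h5, h6⟩ := Finset.mem_filter.1 h1
    obtain rfl : u' = u := Fin.ext (by simp only at h4; omega)
    obtain rfl : v' = v := Fin.ext (by simp only at h5; omega)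
    exact h6
  · intro h
    have h1 := hF h
    rw [S.dirTransClosure_tree, S.boxGraph_adj subset_rfl huv] at h1
    obtain ⟨r, c, h1, h2, h3⟩ := h1
    exact ⟨r, c, Finset.mem_filter.2 ⟨h1, u, v, h2, h3, h⟩, h2, h3⟩

/-- A larger filling still gives an acyclic graph, and a tree is maximal among acyclic graphs. -/
theorem mem_of_isFilling_insert (S : IsShape π g) {E : Finset (ℕ × ℕ)} (hE : E ⊆ region π)
    (hT : (boxGraph π E).IsTree) {b : ℕ × ℕ} (hb : b ∈ region π)
    (hF : IsFilling g (insert b E)) : b ∈ E := by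
  have hE' : insert b E ⊆ region π := Finset.insert_subset hb hE
  have hac := (S.isNoncrossing_boxGraph hE' hF).isAcyclic (S.isAlternating_boxGraph hE' hF)
  have hle : boxGraph π E ≤ boxGraph π (insert b E) := by
    intro u v h
    rw [boxGraph, SimpleGraph.fromRel_adj] at h ⊢
    refine ⟨h.1, h.2.imp ?_ ?_⟩ <;>
    · rintro ⟨b, h1, h2⟩
      exact ⟨b, Finset.mem_insert_of_mem h1, h2⟩
  have hmax := (SimpleGraph.isTree_iff_maximal_isAcyclic.1 hT).2
  exact S.boxGraph_injOn hE' hE (hmax.2 hac hle) (Finset.mem_insert_self b E)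

theorem isFilling_insert {E : Finset (ℕ × ℕ)} (hF : IsFilling g E) {r c : ℕ}
    (h1 : ∀ r' c', (r', c') ∈ E → r < r' → c' < c → height g c < r')
    (h2 : ∀ r' c', (r', c') ∈ E → r' < r → c < c' → height g c' < r) :
    IsFilling g (insert (r, c) E) := by
  intro a b a' b' h h' hr hc
  rw [Finset.mem_insert, Prod.mk.injEq] at h h'
  rcases h with ⟨rfl, rfl⟩ | h <;> rcases h' with ⟨rfl, rfl⟩ | h'
  · omega
  · exact h1 a' b' h' hr hc
  · exact h2 a b h hr hc
  · exact hF a b a' b' h h' hr hc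

theorem isMaximalFilling_of_tree (S : IsShape π g) {E : Finset (ℕ × ℕ)} (hE : E ⊆ region π)
    (hT : (boxGraph π E).IsTree) (hF : IsFilling g E) :
    IsMaximalFilling (height g) (region π \ E) := by
  have hnot : ∀ r c, (r, c) ∉ region π \ E → (r, c) ∈ region π → (r, c) ∈ E := fun r c h hm => by
    by_contra hn
    exact h (Finset.mem_sdiff.2 ⟨hm, hn⟩)
  have hanti := antitone_height S.anti
  have hsub : ∀ r c, height g c < r → (r, c) ∉ region π \ E := fun r c h hm => by
    have := S.le_height (Finset.mem_sdiff.1 hm).1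
    omega
  have hcols : ∀ {r c : ℕ}, 1 ≤ c → 1 < r → r ≤ height g c → c ∈ cols π := by
    intro r c hc hr hrc
    rw [S.mem_cols]
    unfold height at hrc
    omega
  have h11 : (1, 1) ∈ E := by
    refine S.mem_of_isFilling_insert hE hT (S.one_mem S.one_mem_cols) (isFilling_insert hF ?_ ?_)
    · intro r' c' h _ hc
      have := (S.mem_region _ _).1 (hE h)
      omega
    · intro r' c' h hr _
      have := (S.mem_region _ _).1 (hE h)
      omega
  have hcorner : (1, 1) ∉ region π \ E := fun h => (Finset.mem_sdiff.1 h).2 h11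
  refine ⟨?_, hcorner, ?_, ?_⟩
  · intro r c h
    have := (S.mem_region r c).1 (Finset.mem_sdiff.1 h).1
    omega
  · intro c hc
    obtain ⟨t, ht⟩ := exists_isTop (height_pos g) hcorner hc
    obtain ⟨c₀, h1, h2, h3⟩ := ht.covered
    have htpos := ht.pos
    have htle := ht.le
    refine ⟨t, ht, ?_, ?_, fun r hr => hsub r (c + 1) hr⟩
    · intro hm
      obtain ⟨hm, hmE⟩ := Finset.mem_sdiff.1 hm
      refine hmE (S.mem_of_isFilling_insert hE hT hm (isFilling_insert hF ?_ ?_))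
      · intro r' c' h hr' hc'
        by_contra! hle
        exact ht.max r' hr' hle ⟨c', ((S.mem_region _ _).1 (hE h)).2.1, by omega,
          fun h' => (Finset.mem_sdiff.1 h').2 h⟩
      · intro r' c' h hr' hc'
        exact hF r' c' t c₀ h (hnot _ _ h3 (S.region_mono hm htpos le_rfl h1 (by omega))) hr'
          (by omega)
    · intro r hr hrt
      by_contra hn
      have hle₀ : t ≤ height g c₀ := htle.trans (hanti (by omega))
      have hcc : c + 1 ∈ cols π := hcols (by omega) (by omega) htle
      have hrE : (r, c + 1) ∈ E := by
        refine hnot _ _ hn ?_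
        by_contra h4
        have := S.eq_height hcc hr (by omega) h4
        omega
      by_cases h4 : (t, c₀) ∈ region π
      · have := hF r (c + 1) t c₀ hrE (hnot _ _ h3 h4) hrt (by omega)
        omega
      -- If `(t, c₀)` were an outer corner, `t` would exceed `g c₀ + 1`, the height of the next
      -- column, and hence that of column `c + 1`.
      · have hc₀ : c₀ ∈ cols π := hcols h1 (by omega) hle₀
        have h5 := S.eq_height hc₀ htpos hle₀ h4
        have h6 : height g (c + 1) ≤ g c₀ + 1 := hanti (by omega : c₀ + 1 ≤ c + 1)
        rw [S.mem_region_iff hc₀] at h4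
        omega
  · intro c hc r hr
    by_contra hn
    have hmem : ∀ c', 1 ≤ c' → c' ≤ c → (r, c') ∈ region π ∧ (r, c') ∉ E := by
      intro c' h1 h2
      by_contra h3
      exact hn ⟨c', h1, h2, fun h4 => h3 (Finset.mem_sdiff.1 h4)⟩
    have hrc := (hmem c hc le_rfl).1
    have hR := S.mem_rows_of_mem hrc
    obtain ⟨v, hv⟩ := S.exists_nVertex hR
    obtain ⟨v₀, hv₀⟩ := S.exists_eVertex S.one_mem_cols
    have hvv : v₀ ≠ v := by
      rintro rfl
      have := S.eLabel_lt_nLabel (S.mem_one hR)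
      omega
    have : Nontrivial (Fin (numVertices π)) := ⟨v₀, v, hvv⟩
    -- A row ending without an elbow would be an isolated vertex. A neighbour gives either an elbow
    -- in the row or an outer corner at its end, where `hmem` already places a box of R(π).
    obtain ⟨w, hw⟩ := hT.connected.preconnected.exists_adj_of_nontrivial v
    rcases lt_or_gt_of_ne hw.ne with h1 | h1
    · obtain ⟨r₁, c₁, h2, h3, -⟩ := (S.boxGraph_adj hE h1).1 hw
      have hc₁ := S.mem_cols_of_mem (hE h2)
      obtain ⟨h4, h5⟩ := (S.nLabel_eq_eLabel_iff hR hc₁).1 (hv.trans h3.symm)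
      refine h4 (hmem c₁ (S.mem_cols.1 hc₁).1 ?_).1
      by_contra! h6
      have : height g c₁ ≤ height g (c + 1) := hanti h6
      omega
    · obtain ⟨r₁, c₁, h2, -, h3⟩ := (S.boxGraph_adj hE h1).1 hw.symm
      obtain rfl := S.nLabel_inj (S.mem_rows_of_mem (hE h2)) hR (h3.trans hv.symm)
      have hp := (S.mem_region _ _).1 (hE h2)
      refine (hmem c₁ hp.2.1 ?_).2 h2
      by_contra! h6
      have : height g c₁ ≤ height g (c + 1) := hanti h6
      have := S.le_height (hE h2)
      omega

theorem bijOn_mapM (S : IsShape π g) :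
    Set.BijOn (mapM π) {C | IsMaximalFilling (height g) C}
      (ncAltSpanningTrees (dirTransClosure (tree π))) := by
  refine ⟨?_, ?_, ?_⟩
  · intro C hC
    rw [S.mapM_eq hC.corner]
    exact S.boxGraph_mem_ncAltSpanningTrees hC
  · intro C hC C' hC' h
    rw [S.mapM_eq hC.corner, S.mapM_eq hC'.corner] at h
    have h1 : region π \ C = region π \ C' := subset_antisymm
      (S.boxGraph_injOn Finset.sdiff_subset Finset.sdiff_subset h.le)
      (S.boxGraph_injOn Finset.sdiff_subset Finset.sdiff_subset h.ge)
    rw [← Finset.sdiff_sdiff_eq_self (S.subset_region hC), h1,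
      Finset.sdiff_sdiff_eq_self (S.subset_region hC')]
  · rintro F ⟨hle, hT, hn, ha⟩
    obtain ⟨E, hE, rfl⟩ := S.exists_boxGraph_eq hle
    have hC := S.isMaximalFilling_of_tree hE hT (S.isFilling_of_boxGraph hE hn ha)
    refine ⟨region π \ E, hC, ?_⟩
    rw [S.mapM_eq hC.corner, Finset.sdiff_sdiff_eq_self hE]

end IsShape

/-! ### The permutations `1π'` with `π'` dominant -/

theorem mem_rotheDiagram {n : ℕ} {π : Equiv.Perm (Fin n)} {r c : ℕ} :
    (r, c) ∈ rotheDiagram π ↔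
      ∃ i j : Fin n, i < j ∧ π j < π i ∧ (π j : ℕ) + 1 = r ∧ (i : ℕ) + 1 = c := by
  simp only [rotheDiagram, Finset.mem_image, Finset.mem_filter, Finset.mem_univ, true_and,
    Prod.exists, Prod.mk.injEq, and_assoc]

theorem mem_rotheDiagram_onePlus {n : ℕ} {σ : Equiv.Perm (Fin n)} {r c : ℕ} :
    (r, c) ∈ rotheDiagram (onePlus σ) ↔
      2 ≤ r ∧ 2 ≤ c ∧ (r - 1, c - 1) ∈ rotheDiagram σ := by
  rw [mem_rotheDiagram, mem_rotheDiagram]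
  constructor
  · rintro ⟨i, j, h1, h2, h3, h4⟩
    cases i using Fin.cases with
    | zero =>
      rw [onePlus_zero] at h2
      exact absurd h2 (Fin.not_lt_zero _)
    | succ i =>
      cases j using Fin.cases with
      | zero => exact absurd h1 (Fin.not_lt_zero _)
      | succ j =>
        rw [onePlus_succ, Fin.val_succ] at h3
        rw [onePlus_succ, onePlus_succ, Fin.succ_lt_succ_iff] at h2
        rw [Fin.succ_lt_succ_iff] at h1
        rw [Fin.val_succ] at h4
        exact ⟨by omega, by omega, i, j, h1, h2, by omega, by omega⟩
  · rintro ⟨hr, hc, i, j, h1, h2, h3, h4⟩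
    refine ⟨i.succ, j.succ, Fin.succ_lt_succ_iff.2 h1, ?_, ?_, ?_⟩
    · rw [onePlus_succ, onePlus_succ]
      exact Fin.succ_lt_succ_iff.2 h2
    · rw [onePlus_succ, Fin.val_succ]
      omega
    · rw [Fin.val_succ]
      omega

theorem exists_iff_le {p : ℕ → Prop} {N : ℕ} (hN : ∀ r, p r → 1 ≤ r ∧ r ≤ N)
    (hp : ∀ r r', p r → 1 ≤ r' → r' ≤ r → p r') : ∃ b, ∀ r, p r ↔ 1 ≤ r ∧ r ≤ b := by
  classical
  refine ⟨Nat.findGreatest p N, fun r => ⟨fun h => ⟨(hN r h).1, ?_⟩, fun h => ?_⟩⟩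
  · exact Nat.le_findGreatest (hN r h).2 h
  · exact hp _ r (Nat.findGreatest_of_ne_zero rfl (by omega)) h.1 h.2

theorem rowLength_eq {S : Finset (ℕ × ℕ)} {r a b : ℕ}
    (h : ∀ c, (r, c) ∈ S ↔ a ≤ c ∧ c ≤ b) : rowLength S r = b + 1 - a := by
  have : S.filter (fun x => x.1 = r) = (Finset.Icc a b).image (fun c => (r, c)) := by
    ext ⟨r', c⟩
    simp only [Finset.mem_filter, Finset.mem_image, Finset.mem_Icc, Prod.mk.injEq]
    constructor
    · rintro ⟨h1, rfl⟩
      exact ⟨c, (h c).1 h1, rfl, rfl⟩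
    · rintro ⟨c', h1, rfl, rfl⟩
      exact ⟨(h _).2 h1, rfl⟩
  rw [rowLength, this, Finset.card_image_of_injective _ fun x y hxy => by simpa using hxy,
    Nat.card_Icc]

/-- The column lengths of the diagram of `σ`, column `0` being a copy of column `1`. -/
def diagramColumn {n : ℕ} (σ : Equiv.Perm (Fin n)) (c : ℕ) : ℕ :=
  colLength (rotheDiagram σ) (max c 1)

section Dominant

variable {n : ℕ} {σ : Equiv.Perm (Fin n)}

theorem pos_of_mem_rotheDiagram {r c : ℕ} (h : (r, c) ∈ rotheDiagram σ) :
    1 ≤ r ∧ 1 ≤ c ∧ r ≤ n ∧ c ≤ n := by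
  obtain ⟨i, j, -, -, h3, h4⟩ := mem_rotheDiagram.1 h
  omega

/-- All boxes to the left of `(r, c)` are in the diagram, so the first `c` values of `σ` are
distinct and exceed `r`. -/
theorem add_le_of_mem_rotheDiagram (hσ : IsPartition (rotheDiagram σ)) {r c : ℕ}
    (h : (r, c) ∈ rotheDiagram σ) : r + c ≤ n := by
  have hp := pos_of_mem_rotheDiagram h
  have hlt : ∀ i : Fin c, r ≤ (σ ⟨i, by omega⟩ : ℕ) := by
    intro i
    obtain ⟨i', j, -, h2, h3, h4⟩ :=
      mem_rotheDiagram.1 (hσ r c h r ((i : ℕ) + 1) hp.1 le_rfl (by omega) (by omega))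
    have : i' = ⟨(i : ℕ), by omega⟩ := Fin.ext (by simp only; omega)
    rw [← this]
    rw [Fin.lt_def] at h2
    omega
  have hcard := Fintype.card_le_of_injective
    (fun i : Fin c => (⟨(σ ⟨i, by omega⟩ : ℕ) - r, by have := hlt i; omega⟩ : Fin (n - r))) (by
      intro i i' hii
      simp only [Fin.mk.injEq] at hii
      have h1 := hlt i
      have h2 := hlt i'
      have h3 := σ.injective (Fin.ext (by omega : (σ ⟨i, _⟩ : ℕ) = σ ⟨i', _⟩))
      simpa [Fin.ext_iff] using h3)
  rw [Fintype.card_fin, Fintype.card_fin] at hcard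
  omega

theorem mem_rotheDiagram_iff (hσ : IsPartition (rotheDiagram σ)) {r c : ℕ} (hc : 1 ≤ c) :
    (r, c) ∈ rotheDiagram σ ↔ 1 ≤ r ∧ r ≤ diagramColumn σ c := by
  obtain ⟨b, hb⟩ := exists_iff_le (p := fun r => (r, c) ∈ rotheDiagram σ) (N := n)
    (fun r h => ⟨(pos_of_mem_rotheDiagram h).1, (pos_of_mem_rotheDiagram h).2.2.1⟩)
    (fun r r' h h1 h2 => hσ r c h r' c h1 h2 hc le_rfl)
  rw [diagramColumn, max_eq_left hc, colLength_eq hb]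
  exact hb r

theorem diagramColumn_add_le (hσ : IsPartition (rotheDiagram σ)) {c : ℕ} (hc : 1 ≤ c)
    (h : 1 ≤ diagramColumn σ c) : diagramColumn σ c + c ≤ n :=
  add_le_of_mem_rotheDiagram hσ ((mem_rotheDiagram_iff hσ hc).2 ⟨h, le_rfl⟩)

theorem diagramColumn_zero (σ : Equiv.Perm (Fin n)) : diagramColumn σ 0 = diagramColumn σ 1 := rfl

theorem antitone_diagramColumn (hσ : IsPartition (rotheDiagram σ)) :
    Antitone (diagramColumn σ) := by
  have key : ∀ c' c, 1 ≤ c' → c' ≤ c → diagramColumn σ c ≤ diagramColumn σ c' := by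
    intro c' c h1 h2
    rcases Nat.eq_zero_or_pos (diagramColumn σ c) with h3 | h3
    · omega
    · have h4 := (mem_rotheDiagram_iff hσ (h1.trans h2)).2 ⟨h3, le_rfl⟩
      exact ((mem_rotheDiagram_iff hσ h1).1 (hσ _ _ h4 _ c' h3 le_rfl h1 h2)).2
  intro c' c h
  rcases Nat.eq_zero_or_pos c' with rfl | h1
  · rcases Nat.eq_zero_or_pos c with rfl | h2
    · exact le_rfl
    · exact key 1 c le_rfl h2
  · exact key c' c h1 h

theorem mem_bottomDream_onePlus (hσ : IsPartition (rotheDiagram σ)) (r c : ℕ) :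
    (r, c) ∈ bottomDream (onePlus σ) ↔ 1 ≤ c ∧ 2 ≤ r ∧ r ≤ diagramColumn σ c + 1 := by
  simp only [bottomDream, Finset.mem_filter, Finset.mem_product, Finset.mem_Icc]
  rcases Nat.lt_or_ge r 2 with hr | hr
  · have : rowLength (rotheDiagram (onePlus σ)) r = 0 + 1 - 1 :=
      rowLength_eq fun c => by rw [mem_rotheDiagram_onePlus]; omega
    omega
  · obtain ⟨b, hb⟩ := exists_iff_le (p := fun c => (r - 1, c) ∈ rotheDiagram σ) (N := n)
      (fun c h => ⟨(pos_of_mem_rotheDiagram h).2.1, (pos_of_mem_rotheDiagram h).2.2.2⟩)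
      (fun c c' h h1 h2 => hσ _ c h _ c' (by omega) le_rfl h1 h2)
    have h1 : rowLength (rotheDiagram (onePlus σ)) r = b + 1 + 1 - 2 :=
      rowLength_eq fun c => by
        rw [mem_rotheDiagram_onePlus, hb]
        omega
    have h2 := hb c
    rw [h1]
    constructor
    · rintro ⟨⟨h3, h4⟩, h5⟩
      have h6 := (mem_rotheDiagram_iff hσ h4.1).1 (h2.2 ⟨h4.1, by omega⟩)
      omega
    · rintro ⟨h3, h4, h5⟩
      have h6 := (mem_rotheDiagram_iff hσ h3).2 ⟨by omega, (by omega : r - 1 ≤ _)⟩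
      have h7 := add_le_of_mem_rotheDiagram hσ h6
      have h8 := h2.1 h6
      omega

theorem mem_topDream_onePlus (hσ : IsPartition (rotheDiagram σ)) (r c : ℕ) :
    (r, c) ∈ topDream (onePlus σ) ↔ 1 ≤ r ∧ 2 ≤ c ∧ r ≤ diagramColumn σ (c - 1) := by
  simp only [topDream, Finset.mem_filter, Finset.mem_product, Finset.mem_Icc]
  rcases Nat.lt_or_ge c 2 with hc | hc
  · have : colLength (rotheDiagram (onePlus σ)) c = 0 + 1 - 1 :=
      colLength_eq fun r => by rw [mem_rotheDiagram_onePlus]; omega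
    omega
  · have h1 : colLength (rotheDiagram (onePlus σ)) c = diagramColumn σ (c - 1) + 1 + 1 - 2 :=
      colLength_eq fun r => by
        rw [mem_rotheDiagram_onePlus, mem_rotheDiagram_iff hσ (by omega)]
        omega
    rw [h1]
    have h2 := diagramColumn_add_le hσ (c := c - 1) (by omega)
    omega

theorem isShape_onePlus (hσ : IsPartition (rotheDiagram σ)) :
    IsShape (onePlus σ) (diagramColumn σ) where
  anti := antitone_diagramColumn hσ
  zero := diagramColumn_zero σ
  mem_bottom := mem_bottomDream_onePlus hσ
  mem_region r c := by
    have h1 : diagramColumn σ c ≤ diagramColumn σ (c - 1) :=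
      antitone_diagramColumn hσ (Nat.sub_le c 1)
    rw [region, Finset.mem_insert, coreRegion, Finset.mem_union, mem_bottomDream_onePlus hσ,
      mem_topDream_onePlus hσ, Prod.mk.injEq]
    by_cases hc : c = 1
    · subst hc
      have h0 : diagramColumn σ (1 - 1) = diagramColumn σ 1 := rfl
      rw [h0]
      constructor <;> intro h <;> omega
    · omega
  bounded c hc := by
    have := diagramColumn_add_le hσ (c := c) (by omega)
    omega

theorem add_le_of_mem_region (hσ : IsPartition (rotheDiagram σ)) {r c : ℕ}
    (h : (r, c) ∈ region (onePlus σ)) (hne : (r, c) ≠ (1, 1)) : r + c ≤ n + 1 := by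
  rw [region, Finset.mem_insert, coreRegion, Finset.mem_union, mem_bottomDream_onePlus hσ,
      mem_topDream_onePlus hσ] at h
  rcases h.resolve_left hne with h | h
  · have := diagramColumn_add_le hσ (c := c) (by omega)
    omega
  · have := diagramColumn_add_le hσ (c := c - 1) (by omega)
    omega

/-- The one-line notation of a permutation of `{1, …, N}`. -/
def oneLine {N : ℕ} (π : Equiv.Perm (Fin N)) (d : ℕ) : ℕ :=
  if h : d - 1 < N then (π ⟨d - 1, h⟩ : ℕ) + 1 else 0

theorem oneLine_succ {N : ℕ} (π : Equiv.Perm (Fin N)) (j : Fin N) :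
    oneLine π ((j : ℕ) + 1) = (π j : ℕ) + 1 := by
  simp [oneLine]

theorem exists_fin_succ {N d : ℕ} (h : 1 ≤ d) (h' : d ≤ N) : ∃ j : Fin N, d = (j : ℕ) + 1 :=
  ⟨⟨d - 1, by omega⟩, by simp only; omega⟩

theorem isReading_onePlus (hσ : IsPartition (rotheDiagram σ)) :
    IsReading (n + 1) (height (diagramColumn σ)) (oneLine (onePlus σ)) where
  one_le := by omega
  one := by
    have := oneLine_succ (onePlus σ) 0
    rwa [onePlus_zero] at this
  pos d h h' := by
    obtain ⟨j, rfl⟩ := exists_fin_succ h h'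
    rw [oneLine_succ]
    omega
  le d h h' := by
    obtain ⟨j, rfl⟩ := exists_fin_succ h h'
    rw [oneLine_succ]
    omega
  inj d e h1 h2 h3 h4 h := by
    obtain ⟨j, rfl⟩ := exists_fin_succ h1 h2
    obtain ⟨k, rfl⟩ := exists_fin_succ h3 h4
    rw [oneLine_succ, oneLine_succ] at h
    have := (onePlus σ).injective (Fin.ext (by omega : (onePlus σ j : ℕ) = onePlus σ k))
    rw [this]
  surj v h h' := by
    obtain ⟨k, rfl⟩ := exists_fin_succ h h'
    refine ⟨((onePlus σ).symm k : ℕ) + 1, by omega, by omega, ?_⟩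
    rw [oneLine_succ, Equiv.apply_symm_apply]
  lt d h h' := by
    obtain ⟨j, rfl⟩ := exists_fin_succ (by omega : 1 ≤ d) h'
    rw [oneLine_succ, height_succ]
    -- For an empty column the height is `1`, and only position `1` has value `1`. Otherwise the
    -- lowest box of the column is in row `h d` of the diagram, so its value exceeds `h d`.
    rcases Nat.eq_zero_or_pos (diagramColumn σ j) with h1 | h1
    · cases j using Fin.cases with
      | zero => simp at h
      | succ j =>
        rw [h1, onePlus_succ, Fin.val_succ]
        omega
    · have h2 : (diagramColumn σ j + 1, (j : ℕ) + 1) ∈ rotheDiagram (onePlus σ) :=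
        mem_rotheDiagram_onePlus.2 ⟨by omega, h,
          (mem_rotheDiagram_iff hσ (by omega)).2 ⟨by omega, le_rfl⟩⟩
      obtain ⟨i, k, -, h3, h4, h5⟩ := mem_rotheDiagram.1 h2
      obtain rfl : i = j := Fin.ext (by omega)
      rw [Fin.lt_def] at h3
      omega
  le_height d e h1 h2 h3 h := by
    obtain ⟨j, rfl⟩ := exists_fin_succ h1 (by omega : d ≤ n + 1)
    obtain ⟨k, rfl⟩ := exists_fin_succ (by omega : 1 ≤ e) h3
    rw [oneLine_succ, oneLine_succ] at h
    rw [oneLine_succ, height_succ]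
    have h4 : ((onePlus σ k : ℕ) + 1, (j : ℕ) + 1) ∈ rotheDiagram (onePlus σ) :=
      mem_rotheDiagram.2 ⟨j, k, Fin.lt_def.2 (by omega), Fin.lt_def.2 (by omega), rfl, rfl⟩
    obtain ⟨h5, h6, h7⟩ := mem_rotheDiagram_onePlus.1 h4
    have := ((mem_rotheDiagram_iff hσ (by omega)).1 h7).2
    simp only [Nat.add_sub_cancel] at this
    omega
  large d h := by
    obtain ⟨d, rfl⟩ : ∃ e, d = e + 1 := ⟨d - 1, by omega⟩
    rw [height_succ, (isShape_onePlus hσ).bounded d (by omega)]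
  height_pos := IsShape.height_pos _
  antitone := antitone_height (antitone_diagramColumn hσ)

theorem reducedPipeDreams_onePlus (hσ : IsPartition (rotheDiagram σ)) :
    reducedPipeDreams (onePlus σ) = {C | IsMaximalFilling (height (diagramColumn σ)) C} := by
  have hp := isReading_onePlus hσ
  ext C
  rw [reducedPipeDreams, Set.mem_ofPred_eq, Set.mem_ofPred_eq, isReducedPipeDream_iff]
  constructor
  · rintro ⟨h1, h2, h3⟩
    refine IsReadingDream.isMaximalFilling hp ⟨h1, fun d hd hd' => ?_, h3⟩
    obtain ⟨j, rfl⟩ := exists_fin_succ hd hd'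
    rw [oneLine_succ]
    exact h2 j
  · intro h
    refine ⟨fun r c hm => ?_, fun j => ?_, h.crossesOrdered hp.antitone⟩
    · obtain ⟨h1, h2⟩ := h.pos r c hm
      -- Crosses lie in R(π), which apart from `(1, 1)` stays inside the staircase; the exception
      -- matters when `n = 0`.
      refine ⟨h1, h2, add_le_of_mem_region hσ ((isShape_onePlus hσ).subset_region h hm) ?_⟩
      rintro he
      exact h.corner (he ▸ hm)
    · rw [h.strandAt_exit hp _ (by omega) (by omega), oneLine_succ]

end Dominant

end PipeDreams

theorem mainTheorem3 (n : ℕ) (π' : Equiv.Perm (Fin n))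
    (hπ' : PipeDreams.IsPartition (PipeDreams.rotheDiagram π')) :
    Set.BijOn (PipeDreams.mapM (PipeDreams.onePlus π'))
      (PipeDreams.reducedPipeDreams (PipeDreams.onePlus π'))
      (PipeDreams.ncAltSpanningTrees
        (PipeDreams.dirTransClosure (PipeDreams.tree (PipeDreams.onePlus π')))) := by
  rw [PipeDreams.reducedPipeDreams_onePlus hπ']
  exact (PipeDreams.isShape_onePlus hπ').bijOn_mapM
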